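/- Let $T\subset[0,\infty)$ be an at most countable set with $0\in T$. Let $\mathcal P_1(\mathbb R)$ be the set of Borel probability measures on $\mathbb R$ with finite first moment, with the coarsest topology for which $\mu\mapsto\int f\,d\mu$ is continuous for every bounded continuous $f:\mathbb R\to\mathbb R$ and for $f(x)=|x|$. A peacock indexed by $T$ is a family $(\theta_t)_{t\in T}$ in $\mathcal P_1(\mathbb R)$ that increases in convex order, i.e. $\int\varphi\,d\theta_s\le\int\varphi\,d\theta_t$ (in $(-\infty,\infty]$) for all $s\le t$ in $T$ and all convex $\varphi:\mathbb R\to\mathbb R$. Let $\mathsf P_T$ be the set of these peacocks, with the topology inherited from the product topology on $\mathcal P_1(\mathbb R)^T$. All measurability is with respect to Borel $\sigma$-algebras, and $\lambda$ is Lebesgue measure on $[0,1]$. Let $(\mu_t)_{t\in T}\in\mathsf P_T$, let $a\mapsto\tilde\nu^a$ be a measurable map from $[0,1]$ to $\mathcal P_1(\mathbb R)$, and let $\mathcal A$ be the set of all families $(\theta^a)_{a\in[0,1]}$ in $\mathsf P_T$ such that $a\mapsto\theta^a$ is measurable, $\theta^a_0=\tilde\nu^a$ for all $a\in[0,1]$,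 and $\int_0^1\theta^a_t\,da=\mu_t$ for all $t\in T$. Let $c:[0,1]\times\mathsf P_T\to[0,\infty)$ be Borel measurable and such that, for every $a\in[0,1]$, the map $c(a,\cdot)$ is lower semicontinuous and linear, i.e. $c(a,r\theta+(1-r)\theta')=r\,c(a,\theta)+(1-r)\,c(a,\theta')$ for all $r\in[0,1]$ and $\theta,\theta'\in\mathsf P_T$. Put $$\mathsf V_{\mathcal A}:=\inf_{(\theta^a)_{a\in[0,1]}\in\mathcal A}\int_0^1c(a,\theta^a)\,da$$ and assume $\mathsf V_{\mathcal A}<\infty$. If $(\theta^a)_{a\in[0,1]}\in\mathcal A$ attains this infimum, then there is a measurable set $A\subset[0,1]$ with $\lambda(A)=1$ such that for all $a<a'$ in $A$ $$c(a,\theta^a)+c(a',\theta^{a'})\le c(a,\theta')+c(a',\theta'')$$ for any two peacocks $\theta',\theta''\in\mathsf P_T$ with $\theta'_t+\theta''_t=\theta^a_t+\theta^{a'}_t$ for all $t\in T$, $\theta'_0=\theta^a_0$ and $\theta''_0=\theta^{a'}_0$. -/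

import Mathlib

open MeasureTheory Set Topology
open scoped NNReal ENNReal unitInterval

noncomputable section

/-- The set `𝒫₁(ℝ)` of Borel probability measures on `ℝ` with finite first moment. -/
structure ProbMeasOne where
  law : ProbabilityMeasure ℝ
  integrable_id : Integrable (fun x : ℝ => x) (law : Measure ℝ)

namespace ProbMeasOne

/-- The underlying measure on `ℝ`. -/
def meas (μ : ProbMeasOne) : Measure ℝ := (μ.law : Measure ℝ)

/-- The topology `𝒯₁`: the coarsest topology for which `μ ↦ ∫ f dμ` is continuous for all bounded
continuous `f` (these generate the topology of `ProbabilityMeasure ℝ`) and for `f x = |x|`. -/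
instance : TopologicalSpace ProbMeasOne :=
  TopologicalSpace.induced (fun μ : ProbMeasOne => (μ.law, ∫ x, |x| ∂μ.meas)) inferInstance

instance : MeasurableSpace ProbMeasOne := borel ProbMeasOne

instance : BorelSpace ProbMeasOne := ⟨rfl⟩

/-- Convex order: `∫ φ dμ ≤ ∫ φ dν` for all convex `φ : ℝ → ℝ`. For measures with finite first
moment both integrals have values in `(-∞, ∞]`, and `φ` is integrable exactly when its integral is
finite. So the inequality is void if `φ` is not `ν`-integrable, and otherwise it says that `φ` is
also `μ`-integrable, with the inequality between the two real numbers. -/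
def ConvexLE (μ ν : ProbMeasOne) : Prop :=
  ∀ φ : ℝ → ℝ, ConvexOn ℝ univ φ → Integrable φ ν.meas →
    Integrable φ μ.meas ∧ ∫ x, φ x ∂μ.meas ≤ ∫ x, φ x ∂ν.meas

end ProbMeasOne

/-- The set `P_T` of peacocks indexed by `T`: families in `𝒫₁(ℝ)` increasing in convex order. -/
structure Peacock (T : Set ℝ≥0) where
  marginal : T → ProbMeasOne
  convexLE : ∀ s t : T, s ≤ t → (marginal s).ConvexLE (marginal t)

namespace Peacock

variable {T : Set ℝ≥0}

/-- The topology inherited from the product topology on `𝒫₁(ℝ)^T`. -/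
instance : TopologicalSpace (Peacock T) :=
  TopologicalSpace.induced (fun θ : Peacock T => θ.marginal) inferInstance

instance : MeasurableSpace (Peacock T) := borel (Peacock T)

instance : BorelSpace (Peacock T) := ⟨rfl⟩

/-- The measure `θ_t` on `ℝ`. -/
def meas (θ : Peacock T) (t : T) : Measure ℝ := (θ.marginal t).meas

/-- A cost on `P_T` is linear if it respects the convex combinations of peacocks. -/
def IsLinearCost (f : Peacock T → ℝ≥0) : Prop :=
  ∀ (r s : ℝ≥0), r + s = 1 → ∀ θ₁ θ₂ θ : Peacock T,
    (∀ t : T, θ.meas t = r • θ₁.meas t + s • θ₂.meas t) → f θ = r * f θ₁ + s * f θ₂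

/-- The admissible families `(θ^a)_{a ∈ [0,1]}`: measurable in `a`, with `θ^a_0 = ν^a` for all `a`
and `∫_0^1 θ^a_t da = μ_t` (as measures) for all `t`. -/
def admissible (h0 : 0 ∈ T) (μ : Peacock T) (ν : I → ProbMeasOne) : Set (I → Peacock T) :=
  {θ | Measurable θ ∧ (∀ a : I, (θ a).marginal ⟨0, h0⟩ = ν a) ∧
    ∀ (t : T) (s : Set ℝ), MeasurableSet s → ∫⁻ a : I, (θ a).meas t s = μ.meas t s}

/-- The total cost `∫_0^1 c(a, θ^a) da`. -/
def totalCost (c : I → Peacock T → ℝ≥0) (θ : I → Peacock T) : ℝ≥0∞ :=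
  ∫⁻ a : I, (c a (θ a) : ℝ≥0∞)

/-- The value of the optimization problem. -/
def optValue (h0 : 0 ∈ T) (μ : Peacock T) (ν : I → ProbMeasOne)
    (c : I → Peacock T → ℝ≥0) : ℝ≥0∞ :=
  ⨅ θ ∈ admissible h0 μ ν, totalCost c θ

/-- `θ` is an optimizer: it is admissible and attains the value. -/
def IsOptimal (h0 : 0 ∈ T) (μ : Peacock T) (ν : I → ProbMeasOne)
    (c : I → Peacock T → ℝ≥0) (θ : I → Peacock T) : Prop :=
  θ ∈ admissible h0 μ ν ∧ totalCost c θ = optValue h0 μ ν c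

end Peacock

end

/-! Call a pair of indices an edge if the two peacocks of the optimizer sitting there can be
replaced by a cheaper pair with the same sum and the same initial laws. It must be shown that some
null set of indices meets every edge; its complement is then the set `A`.

Two facts combine. The first is a dichotomy (`exists_null_cover_or_coupling`): a family of edges
that is a continuous image of Baire space either has a null vertex cover or carries a probability
measure whose two marginals are bounded by a multiple of Lebesgue measure. To prove it, measure a
family by the least `∫ h²` of a fractional cover `h`. Strict convexity makes minimisers converge in
`L²`, so this energy is continuous along increasing unions, and energy zero yields a null cover. If
the energy is positive, Choquet's capacitability argument gives a compact box of sequences that is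
still large. For each scale `ε`, a maximal `ε`-separated matching in this box must have at least
order `1/ε` edges, as otherwise its neighbourhood would be a cheap cover. The uniform measures on
these matchings have a weak limit with bounded marginal densities.

The second fact (`Peacock.IsOptimal.false_of_coupling`) excludes such a measure. A small multiple of
it fits under Lebesgue measure, and replacing that share of the optimizer by the improving pairs
gives a randomised competitor with the same marginals and strictly lower cost. Averaging over the
randomisation gives an admissible family, and Jensen's inequality (`Peacock.cost_barycenter_le`)
shows that averaging does not raise the cost.

To apply the dichotomy, peacocks are parametrised by families of random variables in `L¹`, which
form a Polish space; the edges together with their improving pairs then form a Borel, hence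
analytic, set. -/

noncomputable section

/-! ### Fractional covers and their energy -/

open Filter

/-- `h` is a fractional cover of the multigraph on `X` whose edges are the pairs `(p e, q e)`,
`e ∈ C`. -/
structure IsFracCover {S X : Type*} [MeasurableSpace X] (p q : S → X) (C : Set S)
    (h : X → ℝ) : Prop where
  measurable : Measurable h
  nonneg : ∀ x, 0 ≤ h x
  le_one : ∀ x, h x ≤ 1
  one_le : ∀ e ∈ C, 1 ≤ h (p e) + h (q e)

/-- The least energy `∫ h²` of a fractional cover. -/
def coverEnergy {S X : Type*} [MeasurableSpace X] (m : Measure X) (p q : S → X) (C : Set S) : ℝ :=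
  sInf ((fun h : X → ℝ => ∫ x, h x ^ 2 ∂m) '' {h | IsFracCover p q C h})

section FracCover

variable {S X : Type*} [MeasurableSpace X] {m : Measure X} {p q : S → X} {C D : Set S} {h h' : X → ℝ}

lemma IsFracCover.mono (hh : IsFracCover p q D h) (hCD : C ⊆ D) : IsFracCover p q C h :=
  ⟨hh.measurable, hh.nonneg, hh.le_one, fun e he => hh.one_le e (hCD he)⟩

lemma isFracCover_one : IsFracCover p q C (fun _ => (1 : ℝ)) :=
  ⟨measurable_const, fun _ => zero_le_one, fun _ => le_rfl, fun _ _ => by norm_num⟩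

lemma IsFracCover.midpoint (hh : IsFracCover p q C h) (hh' : IsFracCover p q C h') :
    IsFracCover p q C (fun x => (h x + h' x) / 2) where
  measurable := (hh.measurable.add hh'.measurable).div_const 2
  nonneg x := by have := hh.nonneg x; have := hh'.nonneg x; linarith
  le_one x := by have := hh.le_one x; have := hh'.le_one x; linarith
  one_le e he := by have := hh.one_le e he; have := hh'.one_le e he; linarith

lemma coverEnergy_le (hh : IsFracCover p q C h) : coverEnergy m p q C ≤ ∫ x, h x ^ 2 ∂m := by
  refine csInf_le ⟨0, ?_⟩ ⟨h, hh, rfl⟩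
  rintro _ ⟨g, -, rfl⟩
  exact integral_nonneg fun x => sq_nonneg _

lemma exists_isFracCover_lt {v : ℝ} (hv : coverEnergy m p q C < v) :
    ∃ h, IsFracCover p q C h ∧ ∫ x, h x ^ 2 ∂m < v := by
  obtain ⟨_, ⟨h, hh, rfl⟩, hlt⟩ := exists_lt_of_csInf_lt
    (Set.Nonempty.image _ ⟨_, isFracCover_one⟩) hv
  exact ⟨h, hh, hlt⟩

lemma coverEnergy_mono (hCD : C ⊆ D) : coverEnergy m p q C ≤ coverEnergy m p q D := by
  refine le_csInf ⟨_, _, isFracCover_one, rfl⟩ ?_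
  rintro _ ⟨g, hg, rfl⟩
  exact coverEnergy_le (IsFracCover.mono hg hCD)

lemma IsFracCover.memLp [IsFiniteMeasure m] (hh : IsFracCover p q C h) : MemLp h 2 m :=
  MemLp.of_bound hh.measurable.aestronglyMeasurable 1 (ae_of_all _ fun x => by
    rw [Real.norm_eq_abs, abs_of_nonneg (hh.nonneg x)]; exact hh.le_one x)

lemma norm_toLp_sq {f : X → ℝ} (hf : MemLp f 2 m) : ‖hf.toLp f‖ ^ 2 = ∫ x, f x ^ 2 ∂m := by
  rw [← real_inner_self_eq_norm_sq, L2.inner_def]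
  refine integral_congr_ae ?_
  filter_upwards [hf.coeFn_toLp] with x hx
  rw [real_inner_self_eq_norm_sq, hx, Real.norm_eq_abs, sq_abs]

/-- The cover energy is continuous along increasing unions, and attained. -/
theorem exists_isFracCover_iUnion [IsFiniteMeasure m] {C : ℕ → Set S} (hC : Monotone C) {v : ℝ}
    (hv : ∀ n, coverEnergy m p q (C n) ≤ v) :
    ∃ h, IsFracCover p q (⋃ n, C n) h ∧ ∫ x, h x ^ 2 ∂m ≤ v := by
  set V : ℕ → ℝ := fun n => coverEnergy m p q (C n) with hV
  have hVmono : Monotone V := fun a b hab => coverEnergy_mono (hC hab)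
  have hbdd : BddAbove (range V) := ⟨v, by rintro _ ⟨n, rfl⟩; exact hv n⟩
  set L := ⨆ n, V n with hL
  have hVL : Tendsto V atTop (𝓝 L) := tendsto_atTop_ciSup hVmono hbdd
  have hVle : ∀ n, V n ≤ L := fun n => le_ciSup hbdd n
  have hLv : L ≤ v := ciSup_le hv
  have hδ : Tendsto (fun n : ℕ => 1 / ((n : ℝ) + 1)) atTop (𝓝 0) :=
    tendsto_one_div_add_atTop_nhds_zero_nat
  have hex : ∀ n : ℕ, ∃ h, IsFracCover p q (C n) h ∧
      ∫ x, h x ^ 2 ∂m < V n + 1 / ((n : ℝ) + 1) := fun n =>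
    exists_isFracCover_lt (lt_add_of_pos_right _ (by positivity))
  choose h hh hlt using hex
  set F : ℕ → Lp ℝ 2 m := fun n => (hh n).memLp.toLp (h n) with hF
  have hFn : ∀ n, ‖F n‖ ^ 2 = ∫ x, h n x ^ 2 ∂m := fun n => norm_toLp_sq _
  -- The midpoint of near-minimisers `n ≤ k` still covers `C n`, so its energy is at least `V n`;
  -- the parallelogram law turns this into closeness.
  have hdist : ∀ n k, n ≤ k → ‖F n - F k‖ ^ 2 ≤ 2 * (L - V n) + 4 * (1 / ((n : ℝ) + 1)) := by
    intro n k hnk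
    have h1 := parallelogram_law_with_norm ℝ (F n) (F k)
    have hmid := (hh n).midpoint ((hh k).mono (hC hnk))
    have h2 : V n ≤ ‖F n + F k‖ ^ 2 / 4 := by
      refine (coverEnergy_le (m := m) hmid).trans (le_of_eq ?_)
      rw [hF]
      simp only
      rw [← MemLp.toLp_add, norm_toLp_sq, ← integral_div]
      refine integral_congr_ae (ae_of_all _ fun x => ?_)
      simp only [Pi.add_apply]
      ring
    have h3 := hlt n
    have h4 := hlt k
    rw [← hFn] at h3 h4
    have h5 : 1 / ((k : ℝ) + 1) ≤ 1 / ((n : ℝ) + 1) := by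
      apply one_div_le_one_div_of_le (by positivity)
      have : (n : ℝ) ≤ k := by exact_mod_cast hnk
      linarith
    have := hVle k
    nlinarith
  have hcauchy : CauchySeq F := by
    refine cauchySeq_of_le_tendsto_0 (fun n => √(2 * (L - V n) + 4 * (1 / ((n : ℝ) + 1)))) ?_ ?_
    · intro a b N ha hb
      wlog hab : a ≤ b generalizing a b
      · rw [dist_comm]; exact this b a hb ha (le_of_not_ge hab)
      rw [dist_eq_norm]
      refine Real.le_sqrt_of_sq_le ((hdist a b hab).trans ?_)
      have h1 := hVmono ha
      have h5 : 1 / ((a : ℝ) + 1) ≤ 1 / ((N : ℝ) + 1) := by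
        apply one_div_le_one_div_of_le (by positivity)
        have : (N : ℝ) ≤ a := by exact_mod_cast ha
        linarith
      linarith
    · have : Tendsto (fun n : ℕ => 2 * (L - V n) + 4 * (1 / ((n : ℝ) + 1))) atTop
          (𝓝 (2 * (L - L) + 4 * 0)) :=
        ((hVL.const_sub L).const_mul 2).add (hδ.const_mul 4)
      have := this.sqrt
      simpa using this
  obtain ⟨G, hG⟩ := cauchySeq_tendsto_of_complete hcauchy
  have hGnorm : ‖G‖ ^ 2 ≤ v := by
    have h1 : Tendsto (fun n => ‖F n‖ ^ 2) atTop (𝓝 (‖G‖ ^ 2)) := hG.norm.pow 2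
    have h2 : Tendsto (fun n : ℕ => V n + 1 / ((n : ℝ) + 1)) atTop (𝓝 (L + 0)) := hVL.add hδ
    have := le_of_tendsto_of_tendsto' h1 h2 fun n => by rw [hFn]; exact (hlt n).le
    linarith
  obtain ⟨ns, hns, hae⟩ := (tendstoInMeasure_of_tendsto_Lp hG).exists_seq_tendsto_ae
  set g : X → ℝ := ⇑G with hg
  have hgm : Measurable g := (Lp.stronglyMeasurable G).measurable
  have hae' : ∀ᵐ x ∂m, Tendsto (fun k => h (ns k) x) atTop (𝓝 (g x)) := by
    have h1 : ∀ᵐ x ∂m, ∀ n, F n x = h n x := ae_all_iff.2 fun n => (hh n).memLp.coeFn_toLp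
    filter_upwards [hae, h1] with x hx hx1
    simpa [hx1] using hx
  -- The limit has to cover every edge, not almost every one. Setting it to `1` on a null measurable
  -- set containing all points of non-convergence ensures this.
  set Z := toMeasurable m {x | ¬ Tendsto (fun k => h (ns k) x) atTop (𝓝 (g x))} with hZ
  have hZm : MeasurableSet Z := measurableSet_toMeasurable _ _
  have hZ0 : m Z = 0 := by rw [hZ, measure_toMeasurable]; exact hae'
  have hZc : ∀ x, x ∉ Z → Tendsto (fun k => h (ns k) x) atTop (𝓝 (g x)) := fun x hx => by
    by_contra hcon
    exact hx (subset_toMeasurable _ _ hcon)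
  classical
  have h0 : ∀ x, x ∉ Z → 0 ≤ g x := fun x hx =>
    ge_of_tendsto' (hZc x hx) fun k => (hh _).nonneg x
  have h1 : ∀ x, x ∉ Z → g x ≤ 1 := fun x hx =>
    le_of_tendsto' (hZc x hx) fun k => (hh _).le_one x
  have hpw0 : ∀ x, 0 ≤ Z.piecewise (fun _ => (1 : ℝ)) g x := fun x => by
    by_cases hx : x ∈ Z
    · simp [hx]
    · simpa [hx] using h0 x hx
  refine ⟨Z.piecewise (fun _ => 1) g, ⟨measurable_const.piecewise hZm hgm, hpw0, fun x => ?_,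
    fun e he => ?_⟩, ?_⟩
  · by_cases hx : x ∈ Z
    · simp [hx]
    · simpa [hx] using h1 x hx
  · by_cases hp : p e ∈ Z
    · have := hpw0 (q e)
      rw [piecewise_eq_of_mem _ _ _ hp]; linarith
    by_cases hq : q e ∈ Z
    · have := hpw0 (p e)
      rw [piecewise_eq_of_mem _ _ _ hq]; linarith
    rw [piecewise_eq_of_notMem _ _ _ hp, piecewise_eq_of_notMem _ _ _ hq]
    obtain ⟨N, hN⟩ := mem_iUnion.1 he
    refine ge_of_tendsto ((hZc _ hp).add (hZc _ hq)) ?_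
    filter_upwards [eventually_ge_atTop N] with k hk
    exact (hh (ns k)).one_le e (hC (hk.trans (hns.le_apply)) hN)
  · refine le_trans (le_of_eq ?_) hGnorm
    rw [← Lp.toLp_coeFn G (Lp.memLp G), norm_toLp_sq]
    refine integral_congr_ae ?_
    have : ∀ᵐ x ∂m, x ∉ Z := measure_eq_zero_iff_ae_notMem.1 hZ0
    filter_upwards [this] with x hx
    rw [piecewise_eq_of_notMem _ _ _ hx]

theorem coverEnergy_iUnion_le [IsFiniteMeasure m] {C : ℕ → Set S} (hC : Monotone C) {v : ℝ}
    (hv : ∀ n, coverEnergy m p q (C n) ≤ v) : coverEnergy m p q (⋃ n, C n) ≤ v := by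
  obtain ⟨h, hh, hle⟩ := exists_isFracCover_iUnion hC hv
  exact (coverEnergy_le hh).trans hle

/-- A multigraph of zero cover energy has a null vertex cover. -/
theorem exists_null_of_coverEnergy_le_zero [IsFiniteMeasure m] (h0 : coverEnergy m p q C ≤ 0) :
    ∃ N, MeasurableSet N ∧ m N = 0 ∧ ∀ e ∈ C, p e ∈ N ∨ q e ∈ N := by
  obtain ⟨h, hh, hle⟩ := exists_isFracCover_iUnion (C := fun _ => C) monotone_const (fun _ => h0)
  have hint : Integrable (fun x => h x ^ 2) m := hh.memLp.integrable_sq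
  have hz : ∀ᵐ x ∂m, h x ^ 2 = 0 :=
    (integral_eq_zero_iff_of_nonneg (fun x => sq_nonneg (h x)) hint).1
      (le_antisymm hle (integral_nonneg fun x => sq_nonneg _))
  -- Both endpoints of an edge cannot be zeros of `h`, since its values there sum to at least `1`.
  refine ⟨{x | h x ≠ 0}, (measurableSet_eq_fun hh.measurable measurable_const).compl, ?_, ?_⟩
  · change m {x | ¬ (h x = 0)} = 0
    rw [← ae_iff]
    filter_upwards [hz] with x hx using by simpa using hx
  · intro e he
    have := hh.one_le e (mem_iUnion.2 ⟨0, he⟩)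
    by_contra! hcon
    simp only [mem_ofPred_eq, not_not] at hcon
    rw [hcon.1, hcon.2] at this
    norm_num at this

end FracCover

end

/-! ### Capacitability and couplings with bounded marginal densities -/

noncomputable section

open Filter

/-- Choquet's argument: bound the coordinates one at a time. Raising the bound on coordinate `k`
exhausts the current set, so by continuity along increasing unions some finite bound keeps the
energy above `v`. -/
lemma exists_bound_coverEnergy {X : Type*} [MeasurableSpace X] {m : Measure X} [IsFiniteMeasure m]
    {p q : (ℕ → ℕ) → X} {v : ℝ} (hv : v < coverEnergy m p q univ) :
    ∃ f : ℕ → ℕ, ∀ k, v < coverEnergy m p q {e | ∀ i < k, e i ≤ f i} := by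
  have step : ∀ (k : ℕ) (f : ℕ → ℕ), v < coverEnergy m p q {e | ∀ i < k, e i ≤ f i} →
      ∃ n, v < coverEnergy m p q {e | ∀ i < k + 1, e i ≤ Function.update f k n i} := by
    intro k f hf
    by_contra! hcon
    have hmono : Monotone fun n : ℕ => {e : ℕ → ℕ | ∀ i < k + 1, e i ≤ Function.update f k n i} := by
      intro n n' hn e he i hi
      refine (he i hi).trans ?_
      by_cases hik : i = k
      · subst hik; simpa using hn
      · simp [hik]
    refine absurd (coverEnergy_iUnion_le hmono hcon) (not_le.2 (hf.trans_le (coverEnergy_mono ?_)))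
    intro e he
    refine mem_iUnion.2 ⟨e k, fun i hi => ?_⟩
    by_cases hik : i = k
    · subst hik; simp
    · simpa [hik] using he i (by omega)
  choose! N hN using step
  let G : (k : ℕ) → {f : ℕ → ℕ // v < coverEnergy m p q {e | ∀ i < k, e i ≤ f i}} := fun k =>
    Nat.rec ⟨fun _ => 0, by simpa using hv⟩
      (fun k f => ⟨Function.update f.1 k (N k f.1), hN k f.1 f.2⟩) k
  have hG : ∀ k, (G (k + 1)).1 = Function.update (G k).1 k (N k (G k).1) := fun k => rfl
  have hstab : ∀ i k, i < k → (G k).1 i = (G (i + 1)).1 i := by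
    intro i k hik
    induction k, hik using Nat.le_induction with
    | base => rfl
    | succ k hk ih =>
      have hki : i ≠ k := by omega
      rw [hG k, Function.update_of_ne hki, ih]
  refine ⟨fun i => (G (i + 1)).1 i, fun k => ?_⟩
  have := (G k).2
  convert this using 4 with e
  refine forall₂_congr fun i hi => ?_
  rw [hstab i k hi]

lemma isCompact_setOf_le (f : ℕ → ℕ) : IsCompact {e : ℕ → ℕ | ∀ i, e i ≤ f i} := by
  have : {e : ℕ → ℕ | ∀ i, e i ≤ f i} = univ.pi fun i => Iic (f i) := by
    ext e; simp [Pi.le_def]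
  rw [this]
  exact isCompact_univ_pi fun i => (finite_Iic (f i)).isCompact

/-- Links cylinders, whose energy is under control, to the compact box: clipping a sequence to the
box moves `p` little once enough coordinates already obey the bound. Otherwise a subsequence of
clipped counterexamples converges, and the unclipped ones have the same limit because they agree on
ever more coordinates. -/
lemma exists_uniform_approx {X : Type*} [PseudoMetricSpace X] {p : (ℕ → ℕ) → X}
    (hp : Continuous p) (f : ℕ → ℕ) {ε : ℝ} (hε : 0 < ε) :
    ∃ k, ∀ e : ℕ → ℕ, (∀ i < k, e i ≤ f i) → dist (p e) (p fun i => min (e i) (f i)) < ε := by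
  by_contra! hcon
  choose e he hd using hcon
  obtain ⟨a, -, φ, hφ, ha⟩ := (isCompact_setOf_le f).tendsto_subseq
    (x := fun k i => min (e k i) (f i)) (fun k i => min_le_right _ _)
  have ha' : Tendsto (fun k => e (φ k)) atTop (𝓝 a) := by
    rw [tendsto_pi_nhds] at ha ⊢
    intro i
    refine (ha i).congr' ?_
    filter_upwards [eventually_gt_atTop i] with k hk
    exact min_eq_left (he (φ k) i (hk.trans_le hφ.le_apply))
  have h := ((hp.tendsto a).comp ha').dist ((hp.tendsto a).comp ha)
  rw [dist_self] at h
  exact not_lt.2 (ge_of_tendsto' h fun k => hd (φ k)) hε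

/-! ### Packing in the unit interval -/

namespace unitInterval

lemma volume_ball_le (x : I) (r : ℝ) : volume (Metric.ball x r) ≤ ENNReal.ofReal (2 * r) := by
  rw [volume_apply, ← Real.volume_ball]
  refine measure_mono ?_
  rintro _ ⟨y, hy, rfl⟩
  exact hy

/-- For `r ≤ 1 / 2` at least one of `x - r` and `x + r` stays in the unit interval, so half of the
ball survives. -/
lemma le_volume_ball (x : I) {r : ℝ} (h1 : r ≤ 1 / 2) :
    ENNReal.ofReal r ≤ volume (Metric.ball x r) := by
  have hx := x.2
  rcases le_or_gt r x with h | h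
  · have hr : 0 ≤ (x : ℝ) - r := by linarith
    rcases le_or_gt r 0 with h0 | h0
    · rw [ENNReal.ofReal_of_nonpos h0]; exact zero_le
    let y : I := ⟨x - r, hr, by linarith [hx.2]⟩
    calc ENNReal.ofReal r = volume (Ioc y x) := by simp [y]
      _ ≤ _ := measure_mono fun z hz => by
        have h2 : (y : ℝ) < z := hz.1
        have h3 : (z : ℝ) ≤ x := hz.2
        have h4 : (y : ℝ) = x - r := rfl
        rw [Metric.mem_ball, Subtype.dist_eq, Real.dist_eq, abs_lt]
        constructor <;> linarith
  · rcases le_or_gt r 0 with h0 | h0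
    · rw [ENNReal.ofReal_of_nonpos h0]; exact zero_le
    let y : I := ⟨x + r, by linarith [hx.1], by linarith⟩
    calc ENNReal.ofReal r = volume (Ico x y) := by simp [y]
      _ ≤ _ := measure_mono fun z hz => by
        have h2 : (x : ℝ) ≤ z := hz.1
        have h3 : (z : ℝ) < y := hz.2
        have h4 : (y : ℝ) = x + r := rfl
        rw [Metric.mem_ball, Subtype.dist_eq, Real.dist_eq, abs_lt]
        constructor <;> linarith

lemma card_mul_le_volume {S : Type*} (M : Finset S) (x : S → I) {ε : ℝ} (h1 : ε ≤ 1)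
    (hsep : ∀ a ∈ M, ∀ b ∈ M, a ≠ b → ε ≤ dist (x a) (x b)) {U : Set I}
    (hU : ∀ a ∈ M, Metric.ball (x a) (ε / 2) ⊆ U) :
    M.card * ENNReal.ofReal (ε / 2) ≤ volume U := by
  calc (M.card : ℝ≥0∞) * ENNReal.ofReal (ε / 2)
      = ∑ _a ∈ M, ENNReal.ofReal (ε / 2) := by rw [Finset.sum_const, nsmul_eq_mul]
    _ ≤ ∑ a ∈ M, volume (Metric.ball (x a) (ε / 2)) :=
        Finset.sum_le_sum fun a _ => le_volume_ball _ (by linarith)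
    _ = volume (⋃ a ∈ M, Metric.ball (x a) (ε / 2)) := by
        rw [measure_biUnion_finset _ fun a _ => Metric.isOpen_ball.measurableSet]
        intro a ha b hb hab
        exact Metric.ball_disjoint_ball (by linarith [hsep a ha b hb hab])
    _ ≤ volume U := measure_mono (iUnion₂_subset hU)

/-- A maximal family of edges whose endpoints are separated in both coordinates. -/
lemma exists_maximal_separated {S : Type*} (p q : S → I) (K : Set S) {ε : ℝ} (h0 : 0 < ε)
    (h1 : ε ≤ 1) :
    ∃ M : Finset S, ↑M ⊆ K ∧ (∀ a ∈ M, ∀ b ∈ M, a ≠ b → ε ≤ dist (p a) (p b)) ∧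
      (∀ a ∈ M, ∀ b ∈ M, a ≠ b → ε ≤ dist (q a) (q b)) ∧
      ∀ a ∈ K, ∃ b ∈ M, dist (p a) (p b) < ε ∨ dist (q a) (q b) < ε := by
  classical
  let P : Finset S → Prop := fun M => ↑M ⊆ K ∧
    (∀ a ∈ M, ∀ b ∈ M, a ≠ b → ε ≤ dist (p a) (p b)) ∧
    (∀ a ∈ M, ∀ b ∈ M, a ≠ b → ε ≤ dist (q a) (q b))
  -- The balls of radius `ε / 2` around the first endpoints are disjoint, each of volume at least `ε
  -- / 2`.
  have hbdd : BddAbove {n | ∃ M, P M ∧ M.card = n} := by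
    refine ⟨⌊2 / ε⌋₊, ?_⟩
    rintro _ ⟨M, hM, rfl⟩
    have := (card_mul_le_volume M p h1 hM.2.1 (U := univ) fun _ _ => subset_univ _)
    rw [measure_univ, ← ENNReal.ofReal_natCast, ← ENNReal.ofReal_mul (by positivity),
      ENNReal.ofReal_le_one] at this
    refine Nat.le_floor ?_
    rw [le_div_iff₀ h0]; linarith
  obtain ⟨M, hM, hcard⟩ := Nat.sSup_mem (s := {n | ∃ M, P M ∧ M.card = n})
    ⟨0, ∅, ⟨by simp, by simp, by simp⟩, rfl⟩ hbdd
  refine ⟨M, hM.1, hM.2.1, hM.2.2, fun a ha => ?_⟩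
  by_contra! hcon
  have haM : a ∉ M := fun h => by
    have := (hcon a h).1
    rw [dist_self] at this; linarith
  have key : ∀ r : S → I, (∀ b ∈ M, ε ≤ dist (r a) (r b)) →
      (∀ a ∈ M, ∀ b ∈ M, a ≠ b → ε ≤ dist (r a) (r b)) →
      ∀ c ∈ insert a M, ∀ b ∈ insert a M, c ≠ b → ε ≤ dist (r c) (r b) := by
    intro r hr hr' c hc b hb hcb
    rcases Finset.mem_insert.1 hc with hca | hc'
    · subst hca
      rcases Finset.mem_insert.1 hb with rfl | hb
      · exact absurd rfl hcb
      · exact hr b hb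
    · rcases Finset.mem_insert.1 hb with hba | hb'
      · rw [dist_comm, hba]; exact hr c hc'
      · exact hr' c hc' b hb' hcb
  have hins : P (insert a M) := by
    refine ⟨?_, key p (fun b hb => (hcon b hb).1) hM.2.1, key q (fun b hb => (hcon b hb).2) hM.2.2⟩
    rw [Finset.coe_insert]
    exact insert_subset ha hM.1
  have := le_csSup hbdd ⟨_, hins, rfl⟩
  rw [Finset.card_insert_of_notMem haM, ← hcard] at this
  omega

end unitInterval

/-- Bounded sequences carry a probability measure (the normalised counting measure of a maximal
separated family of edges) whose marginals are dominated by Lebesgue measure up to scale `ε`. -/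
lemma exists_discrete_coupling {p q : (ℕ → ℕ) → I} (hp : Continuous p) (hq : Continuous q)
    {v : ℝ} (hv : 0 < v) (f : ℕ → ℕ)
    (hf : ∀ k, v < coverEnergy volume p q {e | ∀ i < k, e i ≤ f i}) {ε : ℝ} (h0 : 0 < ε)
    (h1 : ε ≤ 1) :
    ∃ P : ProbabilityMeasure {e : ℕ → ℕ | ∀ i, e i ≤ f i}, ∀ r ∈ ({p, q} : Set ((ℕ → ℕ) → I)),
      ∀ G U : Set I, MeasurableSet G → (∀ x ∈ G, Metric.ball x ε ⊆ U) →
      (P : Measure {e : ℕ → ℕ | ∀ i, e i ≤ f i}) ((fun e => r e) ⁻¹' G)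
        ≤ ENNReal.ofReal (16 / v) * volume U := by
  classical
  set K : Set (ℕ → ℕ) := {e : ℕ → ℕ | ∀ i, e i ≤ f i} with hK
  obtain ⟨M, -, hsp, hsq, hmax⟩ := unitInterval.exists_maximal_separated (fun e : K => p e)
    (fun e : K => q e) univ h0 h1
  obtain ⟨k₁, hk₁⟩ := exists_uniform_approx hp f h0
  obtain ⟨k₂, hk₂⟩ := exists_uniform_approx hq f h0
  -- The radius `2 * ε` allows one `ε` for clipping into the box and one for the maximality of `M`,
  -- so that `W` covers a whole cylinder.
  set W : Set I := (⋃ e ∈ M, Metric.ball (p e) (2 * ε)) ∪ ⋃ e ∈ M, Metric.ball (q e) (2 * ε) with hW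
  have hWo : IsOpen W := (isOpen_biUnion fun _ _ => Metric.isOpen_ball).union
    (isOpen_biUnion fun _ _ => Metric.isOpen_ball)
  have hcover : IsFracCover p q {e | ∀ i < max k₁ k₂, e i ≤ f i}
      (W.indicator fun _ => (1 : ℝ)) := by
    have hn : ∀ x, 0 ≤ W.indicator (fun _ => (1 : ℝ)) x :=
      fun x => indicator_nonneg (fun _ _ => zero_le_one) x
    refine ⟨measurable_const.indicator hWo.measurableSet, hn,
      fun x => indicator_le_self' (fun _ _ => zero_le_one) x, fun e he => ?_⟩
    obtain ⟨b, hb, hd⟩ := hmax ⟨fun i => min (e i) (f i), fun i => min_le_right _ _⟩ trivial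
    rcases hd with hd | hd
    · have : p e ∈ W := Or.inl (mem_iUnion₂.2 ⟨b, hb, by
        rw [Metric.mem_ball]
        have := hk₁ e fun i hi => he i (hi.trans_le (le_max_left _ _))
        linarith [dist_triangle (p e) (p fun i => min (e i) (f i)) (p b)]⟩)
      rw [indicator_of_mem this]
      linarith [hn (q e)]
    · have : q e ∈ W := Or.inr (mem_iUnion₂.2 ⟨b, hb, by
        rw [Metric.mem_ball]
        have := hk₂ e fun i hi => he i (hi.trans_le (le_max_right _ _))
        linarith [dist_triangle (q e) (q fun i => min (e i) (f i)) (q b)]⟩)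
      rw [indicator_of_mem this]
      linarith [hn (p e)]
  have hWvol : volume W ≤ ENNReal.ofReal (8 * M.card * ε) := by
    have hb : ∀ r : (ℕ → ℕ) → I, volume (⋃ e ∈ M, Metric.ball (r e) (2 * ε)) ≤
        ENNReal.ofReal (4 * M.card * ε) := fun r => by
      refine (measure_biUnion_finset_le _ _).trans ((Finset.sum_le_sum fun e _ =>
        unitInterval.volume_ball_le _ _).trans (le_of_eq ?_))
      rw [Finset.sum_const, nsmul_eq_mul, ← ENNReal.ofReal_natCast,
        ← ENNReal.ofReal_mul (by positivity)]
      ring_nf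
    refine (measure_union_le _ _).trans ((add_le_add (hb p) (hb q)).trans (le_of_eq ?_))
    rw [← ENNReal.ofReal_add (by positivity) (by positivity)]
    ring_nf
  have hcard : v < 8 * M.card * ε := by
    refine (hf _).trans_le ((coverEnergy_le hcover).trans ?_)
    have : (fun x => W.indicator (fun _ => (1 : ℝ)) x ^ 2) = W.indicator fun _ => (1 : ℝ) := by
      ext x; by_cases hx : x ∈ W <;> simp [hx]
    rw [this, integral_indicator_const _ hWo.measurableSet, smul_eq_mul, mul_one]
    exact ENNReal.toReal_le_of_le_ofReal (by positivity) hWvol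
  have hMpos : (0 : ℝ) < M.card := by
    by_contra h
    have : (M.card : ℝ) = 0 := le_antisymm (not_lt.1 h) (by positivity)
    rw [this] at hcard; linarith
  have hMne : (M.card : ℝ≥0∞) ≠ 0 := by
    have : M.card ≠ 0 := by exact_mod_cast hMpos.ne'
    exact_mod_cast this
  let P₀ : Measure K := (M.card : ℝ≥0∞)⁻¹ • ∑ e ∈ M, Measure.dirac e
  have hP₀ : ∀ s, MeasurableSet s → P₀ s = (M.card : ℝ≥0∞)⁻¹ * (M.filter (· ∈ s)).card := by
    intro s hs
    simp only [P₀, Measure.smul_apply, Measure.coe_finsetSum, Finset.sum_apply, smul_eq_mul,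
      Measure.dirac_apply' _ hs, indicator_apply, Pi.one_apply, Finset.card_filter]
    push_cast
    rfl
  have hprob : IsProbabilityMeasure P₀ := ⟨by
    rw [hP₀ _ MeasurableSet.univ]
    simp only [mem_univ, Finset.filter_true]
    exact ENNReal.inv_mul_cancel hMne (ENNReal.natCast_ne_top _)⟩
  refine ⟨⟨P₀, hprob⟩, fun r hr G U hG hGU => ?_⟩
  have hrc : Continuous r := by rcases hr with rfl | rfl <;> assumption
  have hsr : ∀ a ∈ M, ∀ b ∈ M, a ≠ b → ε ≤ dist (r a) (r b) := by
    rcases hr with rfl | rfl <;> assumption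
  change P₀ _ ≤ _
  have hrm : Measurable fun e : K => r e := hrc.measurable.comp measurable_subtype_coe
  rw [hP₀ _ (hrm hG)]
  have h2 := unitInterval.card_mul_le_volume (M.filter (· ∈ (fun e : K => r e) ⁻¹' G))
    (fun e : K => r e) h1 (fun a ha b hb => hsr a (Finset.mem_filter.1 ha).1 b
      (Finset.mem_filter.1 hb).1) (U := U) (fun a ha =>
        (Metric.ball_subset_ball (by linarith)).trans (hGU _ (Finset.mem_filter.1 ha).2))
  set c := (M.filter (· ∈ (fun e : K => r e) ⁻¹' G)).card
  -- Each atom weighs less than `8 * ε / v` by `hcard`, that is, `16 / v` times the volume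
  -- guaranteed for its own ball of radius `ε / 2`.
  have h3 : (M.card : ℝ≥0∞)⁻¹ ≤ ENNReal.ofReal (16 / v) * ENNReal.ofReal (ε / 2) := by
    rw [← ENNReal.ofReal_natCast, ← ENNReal.ofReal_inv_of_pos hMpos,
      ← ENNReal.ofReal_mul (by positivity)]
    refine ENNReal.ofReal_le_ofReal ?_
    rw [inv_le_iff_one_le_mul₀ hMpos]
    rw [show 16 / v * (ε / 2) * M.card = 8 * M.card * ε / v by ring, le_div_iff₀ hv]
    linarith
  calc (M.card : ℝ≥0∞)⁻¹ * c ≤ ENNReal.ofReal (16 / v) * ENNReal.ofReal (ε / 2) * c := by gcongr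
    _ = ENNReal.ofReal (16 / v) * (c * ENNReal.ofReal (ε / 2)) := by ring
    _ ≤ _ := by gcongr

/-- A multigraph on the unit interval parametrised continuously by Baire space has a null vertex
cover, or it carries a probability measure whose marginals have bounded densities. -/
theorem exists_null_cover_or_coupling {p q : (ℕ → ℕ) → I} (hp : Continuous p)
    (hq : Continuous q) :
    (∃ N, MeasurableSet N ∧ volume N = 0 ∧ ∀ e, p e ∈ N ∨ q e ∈ N) ∨
    ∃ (P : ProbabilityMeasure (ℕ → ℕ)) (C : ℝ≥0),
      (P : Measure (ℕ → ℕ)).map p ≤ C • volume ∧ (P : Measure (ℕ → ℕ)).map q ≤ C • volume := by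
  rcases le_or_gt (coverEnergy volume p q univ) 0 with hV | hV
  · obtain ⟨N, hN, hN0, hcov⟩ := exists_null_of_coverEnergy_le_zero hV
    exact Or.inl ⟨N, hN, hN0, fun e => hcov e trivial⟩
  right
  obtain ⟨v, hv, hvV⟩ := exists_between hV
  obtain ⟨f, hf⟩ := exists_bound_coverEnergy hvV
  set K : Set (ℕ → ℕ) := {e : ℕ → ℕ | ∀ i, e i ≤ f i} with hK
  have : CompactSpace K := isCompact_iff_compactSpace.1 (isCompact_setOf_le f)
  choose P hP using fun n : ℕ => exists_discrete_coupling hp hq hv f hf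
    (ε := 1 / ((n : ℝ) + 1)) (by positivity) (by
      rw [div_le_one (by positivity)]; linarith [(Nat.cast_nonneg n : (0 : ℝ) ≤ n)])
  obtain ⟨Q, φ, hφ, hQ⟩ := CompactSpace.tendsto_subseq P
  have hε : Tendsto (fun n : ℕ => 1 / (((φ n : ℕ) : ℝ) + 1)) atTop (𝓝 0) :=
    tendsto_one_div_add_atTop_nhds_zero_nat.comp hφ.tendsto_atTop
  have key : ∀ r ∈ ({p, q} : Set ((ℕ → ℕ) → I)), Continuous r →
      ((Q : Measure K).map Subtype.val).map r ≤ (16 / v).toNNReal • volume := by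
    intro r hr hrc
    have hrm : Measurable fun e : K => r e := hrc.measurable.comp measurable_subtype_coe
    rw [Measure.map_map hrc.measurable measurable_subtype_coe]
    change (Q : Measure K).map (fun e : K => r e) ≤ _
    have hopen : ∀ U : Set I, IsOpen U →
        (Q : Measure K).map (fun e : K => r e) U ≤ ENNReal.ofReal (16 / v) * volume U := by
      intro U hU
      -- Exhausting `U` by points away from its complement absorbs the `ε`-enlargement in the
      -- discrete bound, and the portmanteau theorem passes that bound on the open `G n` to the
      -- limit.
      let G : ℕ → Set I := fun n => {x | ENNReal.ofReal (1 / ((n : ℝ) + 1)) < Metric.infEDist x Uᶜ}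
      have hGo : ∀ n, IsOpen (G n) := fun n =>
        isOpen_lt continuous_const Metric.continuous_infEDist
      have hGmono : Monotone G := fun a b hab x hx => lt_of_le_of_lt (ENNReal.ofReal_le_ofReal (by
        apply one_div_le_one_div_of_le (by positivity)
        have : (a : ℝ) ≤ b := by exact_mod_cast hab
        linarith)) hx
      have hGU : U = ⋃ n, G n := by
        ext x
        simp only [mem_iUnion]
        constructor
        · intro hx
          have hpos : 0 < Metric.infEDist x Uᶜ := by
            rw [pos_iff_ne_zero]
            intro h
            have := (Metric.mem_iff_infEDist_zero_of_closed hU.isClosed_compl).2 h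
            exact this hx
          have ht : Tendsto (fun n : ℕ => ENNReal.ofReal (1 / ((n : ℝ) + 1))) atTop (𝓝 0) := by
            simpa using ENNReal.tendsto_ofReal (tendsto_one_div_add_atTop_nhds_zero_nat (𝕜 := ℝ))
          exact (ht.eventually_lt_const hpos).exists
        · rintro ⟨n, hn⟩
          by_contra hx
          have : Metric.infEDist x Uᶜ = 0 := Metric.infEDist_zero_of_mem hx
          simp [G, this] at hn
      have hGbound : ∀ n, (Q : Measure K).map (fun e : K => r e) (G n) ≤
          ENNReal.ofReal (16 / v) * volume U := by
        intro n
        rw [Measure.map_apply hrm (hGo n).measurableSet]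
        refine (ProbabilityMeasure.le_liminf_measure_open_of_tendsto hQ
          ((hGo n).preimage (hrc.comp continuous_subtype_val))).trans ?_
        refine liminf_le_of_frequently_le' (Eventually.frequently ?_)
        filter_upwards [hφ.tendsto_atTop.eventually_ge_atTop n] with j hj
        refine hP (φ j) r hr (G n) U (hGo n).measurableSet fun x hx y hy => ?_
        by_contra hyU
        have h1 : Metric.infEDist x Uᶜ ≤ edist x y := Metric.infEDist_le_edist_of_mem hyU
        have h2 : edist x y ≤ ENNReal.ofReal (1 / ((n : ℝ) + 1)) := by
          rw [edist_dist, dist_comm]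
          refine ENNReal.ofReal_le_ofReal ((Metric.mem_ball.1 hy).le.trans ?_)
          apply one_div_le_one_div_of_le (by positivity)
          have : (n : ℝ) ≤ φ j := by exact_mod_cast hj
          linarith
        exact absurd (lt_of_lt_of_le hx (h1.trans h2)) (lt_irrefl _)
      rw [hGU, hGmono.measure_iUnion, ← hGU]
      exact iSup_le hGbound
    -- Outer regularity of Lebesgue measure extends the bound from open to measurable sets.
    refine Measure.le_intro fun s hs _ => ?_
    rw [Measure.smul_apply, Set.measure_eq_iInf_isOpen s volume, ENNReal.smul_def, smul_eq_mul]
    change _ ≤ ENNReal.ofReal (16 / v) * _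
    rw [ENNReal.mul_iInf_of_ne (by simpa using hv) ENNReal.ofReal_ne_top]
    refine le_iInf fun U => ?_
    rw [ENNReal.mul_iInf_of_ne (by simpa using hv) ENNReal.ofReal_ne_top]
    refine le_iInf fun hsU => ?_
    rw [ENNReal.mul_iInf_of_ne (by simpa using hv) ENNReal.ofReal_ne_top]
    exact le_iInf fun hU => (measure_mono hsU).trans (hopen U hU)
  exact ⟨Q.map measurable_subtype_coe.aemeasurable, (16 / v).toNNReal, key p (by simp) hp,
    key q (by simp) hq⟩

end

/-! ### Topology and measurability of peacocks, and their parametrisation by `L¹` -/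

noncomputable section

open Filter

/-- If the topology of a second countable space is induced by a family of maps, then measurability
can be tested on these maps. -/
lemma Topology.IsInducing.measurable_of_forall {Ω X ι : Type*} [MeasurableSpace Ω]
    [TopologicalSpace X] [MeasurableSpace X] [BorelSpace X] [SecondCountableTopology X]
    {Y : ι → Type*} [∀ i, TopologicalSpace (Y i)] [∀ i, MeasurableSpace (Y i)]
    [∀ i, OpensMeasurableSpace (Y i)] {g : X → ∀ i, Y i} (hg : IsInducing g) {f : Ω → X}
    (hf : ∀ i, Measurable fun ω => g (f ω) i) : Measurable f := by
  have htop : ‹TopologicalSpace X› = TopologicalSpace.generateFrom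
      (⋃ i, {s | IsOpen[TopologicalSpace.induced (fun x => g x i) inferInstance] s}) := by
    rw [hg.eq_induced, induced_to_pi]
    exact (generateFrom_iUnion_isOpen fun i => TopologicalSpace.induced (fun x => g x i) _).symm
  have hb := borel_eq_generateFrom_of_subbasis htop
  rw [← BorelSpace.measurable_eq (α := X)] at hb
  rw [hb]
  refine measurable_generateFrom fun s hs => ?_
  obtain ⟨i, hi⟩ := mem_iUnion.1 hs
  obtain ⟨U, hU, rfl⟩ := isOpen_induced_iff.1 hi
  exact hf i hU.measurableSet

lemma LipschitzWith.abs_le_add_mul_abs {φ : ℝ → ℝ} {K : ℝ≥0} (h : LipschitzWith K φ) (x : ℝ) :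
    |φ x| ≤ |φ 0| + K * |x| := by
  have h1 := h.dist_le_mul x 0
  rw [Real.dist_eq, Real.dist_eq, sub_zero] at h1
  have h2 := abs_add_le (φ x - φ 0) (φ 0)
  rw [sub_add_cancel] at h2
  linarith

namespace ProbMeasOne

instance (μ : ProbMeasOne) : IsProbabilityMeasure μ.meas :=
  inferInstanceAs (IsProbabilityMeasure (μ.law : Measure ℝ))

lemma ext_meas {μ ν : ProbMeasOne} (h : μ.meas = ν.meas) : μ = ν := by
  cases μ; cases ν
  simp only [ProbMeasOne.mk.injEq]
  exact Subtype.ext h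

lemma integrable_lipschitz (μ : ProbMeasOne) {φ : ℝ → ℝ} {K : ℝ≥0} (h : LipschitzWith K φ) :
    Integrable φ μ.meas := by
  refine Integrable.mono' ((integrable_const |φ 0|).add (μ.integrable_id.abs.const_mul K))
    h.continuous.aestronglyMeasurable (ae_of_all _ fun x => ?_)
  exact h.abs_le_add_mul_abs x

lemma isInducing_law_moment :
    IsInducing fun μ : ProbMeasOne => (μ.law, ∫ x, |x| ∂μ.meas) := ⟨rfl⟩

lemma tendsto_iff {ι : Type*} {l : Filter ι} {μs : ι → ProbMeasOne} {μ : ProbMeasOne} :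
    Tendsto μs l (𝓝 μ) ↔ Tendsto (fun i => (μs i).law) l (𝓝 μ.law) ∧
      Tendsto (fun i => ∫ x, |x| ∂(μs i).meas) l (𝓝 (∫ x, |x| ∂μ.meas)) := by
  rw [isInducing_law_moment.tendsto_nhds_iff, nhds_prod_eq, tendsto_prod_iff']
  rfl

lemma continuous_law : Continuous fun μ : ProbMeasOne => μ.law :=
  continuous_fst.comp isInducing_law_moment.continuous

/-- The test integrals that generate the topology. -/
def testIntegrals (μ : ProbMeasOne) : Option (BoundedContinuousFunction ℝ ℝ) → ℝ
  | none => ∫ x, |x| ∂μ.meas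
  | some f => ∫ x, f x ∂μ.meas

lemma isInducing_testIntegrals : IsInducing testIntegrals := by
  have key : ∀ (l : Filter ProbMeasOne) (μ : ProbMeasOne), l ≤ 𝓝 μ ↔
      Tendsto testIntegrals l (𝓝 (testIntegrals μ)) := by
    intro l μ
    have h := tendsto_iff (l := l) (μs := id) (μ := μ)
    rw [tendsto_id'] at h
    rw [h, ProbabilityMeasure.tendsto_iff_forall_integral_tendsto, tendsto_pi_nhds,
      Option.forall, and_comm]
    rfl
  refine isInducing_iff_nhds.2 fun μ => le_antisymm ?_ ?_
  · rw [← tendsto_iff_comap]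
    exact (key _ _).1 le_rfl
  · exact (key _ _).2 tendsto_comap

/-- By the portmanteau theorem the mass of an open set is lower semicontinuous, and open sets form a
generating π-system. -/
lemma measurable_meas : Measurable ProbMeasOne.meas := by
  refine Measurable.measure_of_isPiSystem_of_isProbabilityMeasure
    (BorelSpace.measurable_eq (α := ℝ)) isPiSystem_isOpen fun U hU => ?_
  refine LowerSemicontinuous.measurable fun μ => ?_
  refine lowerSemicontinuousAt_iff_le_liminf.2 ?_
  exact ProbabilityMeasure.le_liminf_measure_open_of_tendsto (continuous_law.tendsto μ) hU

/-! ### Random variables on the unit interval -/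

/-- The law of an integrable random variable on the unit interval. -/
def ofLp (X : Lp ℝ 1 (volume : Measure I)) : ProbMeasOne where
  law := ⟨(volume : Measure I).map X, Measure.isProbabilityMeasure_map (Lp.aestronglyMeasurable X).aemeasurable⟩
  integrable_id := by
    change Integrable (fun x : ℝ => x) ((volume : Measure I).map X)
    rw [integrable_map_measure (g := fun x : ℝ => x) continuous_id.aestronglyMeasurable
      (Lp.aestronglyMeasurable X).aemeasurable]
    exact L1.integrable_coeFn X

lemma meas_ofLp (X : Lp ℝ 1 (volume : Measure I)) :
    (ofLp X).meas = (volume : Measure I).map X := rfl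

lemma integral_ofLp (X : Lp ℝ 1 (volume : Measure I)) {φ : ℝ → ℝ} (hφ : Continuous φ) :
    ∫ x, φ x ∂(ofLp X).meas = ∫ a, φ (X a) := by
  rw [meas_ofLp, integral_map (Lp.aestronglyMeasurable X).aemeasurable hφ.aestronglyMeasurable]

lemma integrable_comp_Lp (X : Lp ℝ 1 (volume : Measure I)) {φ : ℝ → ℝ} {K : ℝ≥0}
    (hφ : LipschitzWith K φ) : Integrable (fun a => φ (X a)) (volume : Measure I) :=
  ((ofLp X).integrable_lipschitz hφ).comp_aemeasurable (Lp.aestronglyMeasurable X).aemeasurable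

lemma continuous_integral_ofLp {φ : ℝ → ℝ} {K : ℝ≥0} (hφ : LipschitzWith K φ) :
    Continuous fun X : Lp ℝ 1 (volume : Measure I) => ∫ x, φ x ∂(ofLp X).meas := by
  refine LipschitzWith.continuous (K := K) (LipschitzWith.of_dist_le_mul fun X Y => ?_)
  rw [integral_ofLp X hφ.continuous, integral_ofLp Y hφ.continuous, dist_eq_norm, dist_eq_norm,
    ← integral_sub (integrable_comp_Lp X hφ) (integrable_comp_Lp Y hφ), L1.norm_eq_integral_norm,
    ← integral_const_mul]
  refine norm_integral_le_of_norm_le ((L1.integrable_coeFn (X - Y)).norm.const_mul _) ?_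
  filter_upwards [Lp.coeFn_sub X Y] with a ha
  rw [ha, ← dist_eq_norm, Pi.sub_apply, ← dist_eq_norm]
  exact hφ.dist_le_mul _ _

/-- Weak convergence can be tested on bounded Lipschitz functions, whose integrals are Lipschitz in
the `L¹` norm; so is the first absolute moment. -/
lemma continuous_ofLp : Continuous ofLp := by
  refine continuous_iff_continuousAt.2 fun X => tendsto_iff.2 ⟨?_, ?_⟩
  · refine tendsto_iff_forall_lipschitz_integral_tendsto.2 fun f _ ⟨L, hL⟩ => ?_
    exact (continuous_integral_ofLp hL).tendsto X
  · exact (continuous_integral_ofLp (φ := fun x => |x|) (K := 1)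
      (lipschitzWith_one_norm (E := ℝ))).tendsto X

lemma exists_ofLp_eq (μ : ProbMeasOne) : ∃ X, ofLp X = μ := by
  obtain ⟨f, hf, hfμ⟩ := Measure.exists_measurable_map_eq μ.meas
  have hint : Integrable f (volume : Measure I) := by
    have : Integrable (fun x : ℝ => x) ((volume : Measure I).map f) := by
      rw [hfμ]; exact μ.integrable_id
    exact this.comp_measurable hf
  refine ⟨hint.toL1 f, ext_meas ?_⟩
  rw [meas_ofLp, ← hfμ]
  exact Measure.map_congr hint.coeFn_toL1

/-- Separability is inherited from `L¹` through the continuous surjection `ofLp`. -/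
instance : SecondCountableTopology ProbMeasOne := by
  have h1 : TopologicalSpace.PseudoMetrizableSpace ProbMeasOne :=
    isInducing_law_moment.pseudoMetrizableSpace
  have : Fact ((1 : ℝ≥0∞) ≠ ∞) := ⟨ENNReal.one_ne_top⟩
  have h2 : TopologicalSpace.SeparableSpace ProbMeasOne :=
    (show DenseRange ofLp from (Function.Surjective.denseRange fun μ => exists_ofLp_eq μ)).separableSpace
      continuous_ofLp
  let := TopologicalSpace.pseudoMetrizableSpacePseudoMetric ProbMeasOne
  exact UniformSpace.secondCountable_of_separable _

lemma measurable_of_meas {Ω : Type*} [MeasurableSpace Ω] {f : Ω → ProbMeasOne}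
    (hf : Measurable fun ω => (f ω).meas) : Measurable f := by
  have key : ∀ φ : ℝ → ℝ, Continuous φ → Measurable fun ω => ∫ x, φ x ∂(f ω).meas := by
    intro φ hφ
    let κ : ProbabilityTheory.Kernel Ω ℝ := ⟨fun ω => (f ω).meas, hf⟩
    have : ProbabilityTheory.IsMarkovKernel κ :=
      ⟨fun ω => inferInstanceAs (IsProbabilityMeasure (f ω).meas)⟩
    exact (StronglyMeasurable.integral_kernel (κ := κ) (f := φ) hφ.stronglyMeasurable).measurable
  refine isInducing_testIntegrals.measurable_of_forall fun i => ?_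
  cases i with
  | none => exact key _ continuous_abs
  | some φ => exact key _ φ.continuous

/-! ### Convex order through Lipschitz functions -/

/-- A convex function is a supremum of countably many affine ones, hence an increasing limit of
Lipschitz convex functions. Lipschitz tests are always integrable and their integrals depend
continuously on the random variable, so the order becomes a closed condition. -/
theorem convexLE_iff_lipschitz {μ ν : ProbMeasOne} :
    μ.ConvexLE ν ↔ ∀ φ : ℝ → ℝ, ConvexOn ℝ univ φ → (∃ K, LipschitzWith K φ) →
      ∫ x, φ x ∂μ.meas ≤ ∫ x, φ x ∂ν.meas := by
  refine ⟨fun h φ hφ ⟨K, hK⟩ => (h φ hφ (ν.integrable_lipschitz hK)).2, fun h φ hφ hint => ?_⟩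
  have hcont : Continuous φ := continuousOn_univ.1 (hφ.continuousOn isOpen_univ)
  obtain ⟨l, c, hle, hsup⟩ := hφ.real_univ_sSup_of_nat_affine_eq hcont.lowerSemicontinuous
  set f : ℕ → ℝ → ℝ := fun i x => l i x + c i with hf
  have hfle : ∀ i x, f i x ≤ φ x := fun i x => hle i x
  have hfsup : ∀ x, ⨆ i, f i x = φ x := fun x => by
    have := congrFun hsup x
    rwa [iSup_apply] at this
  have hfl : ∀ i, LipschitzWith ‖l i‖₊ (f i) := fun i => LipschitzWith.of_dist_le_mul fun x y => by
    simpa [hf] using (l i).lipschitz.dist_le_mul x y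
  have hfc : ∀ i, ConvexOn ℝ univ (f i) := fun i =>
    ((l i).toLinearMap.convexOn convex_univ).add (convexOn_const _ convex_univ)
  set g : ℕ → ℝ → ℝ := fun n => partialSups f n with hg
  have hgs : ∀ n, g (n + 1) = g n ⊔ f (n + 1) := fun n => by
    simp only [hg]; rw [← Order.succ_eq_add_one, partialSups_succ]
  have hg0 : g 0 = f 0 := partialSups_zero f
  have hgc : ∀ n, ConvexOn ℝ univ (g n) := fun n => by
    induction n with
    | zero => rw [hg0]; exact hfc 0
    | succ n ih => rw [hgs]; exact ih.sup (hfc _)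
  have hgl : ∀ n, ∃ K, LipschitzWith K (g n) := fun n => by
    induction n with
    | zero => rw [hg0]; exact ⟨_, hfl 0⟩
    | succ n ih =>
      obtain ⟨K, hK⟩ := ih
      rw [hgs]
      exact ⟨_, hK.max (hfl (n + 1))⟩
  have hgmono : Monotone g := (partialSups f).monotone
  have hgle : ∀ n x, g n x ≤ φ x := fun n x => by
    have : partialSups f n ≤ φ := partialSups_le f n φ fun i _ x => hfle i x
    exact this x
  have hglim : ∀ x, Tendsto (fun n => g n x) atTop (𝓝 (φ x)) := fun x => by
    refine tendsto_atTop_isLUB (fun a b hab => hgmono hab x) ⟨?_, fun b hb => ?_⟩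
    · rintro _ ⟨n, rfl⟩; exact hgle n x
    · rw [← hfsup x]
      exact ciSup_le fun i => (le_partialSups f i x).trans (hb ⟨i, rfl⟩)
  choose K hK using hgl
  have hgμ : ∀ n, Integrable (g n) μ.meas := fun n => μ.integrable_lipschitz (hK n)
  have hgν : ∀ n, Integrable (g n) ν.meas := fun n => ν.integrable_lipschitz (hK n)
  have hbound : ∀ n, ∫ x, g n x ∂μ.meas ≤ ∫ x, φ x ∂ν.meas := fun n =>
    (h _ (hgc n) ⟨_, hK n⟩).trans (integral_mono (hgν n) hint (hgle n))
  have hmono0 : ∀ n x, 0 ≤ g n x - g 0 x := fun n x => sub_nonneg.2 (hgmono (Nat.zero_le n) x)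
  -- Subtracting `g 0` makes the integrands nonnegative, so Fatou's lemma yields integrability under
  -- `μ`.
  have hdiff : Integrable (fun x => φ x - g 0 x) μ.meas := by
    refine ⟨(hcont.sub (hK 0).continuous).aestronglyMeasurable, ?_⟩
    rw [hasFiniteIntegral_iff_ofReal (ae_of_all _ fun x => sub_nonneg.2 (hgle 0 x))]
    have hfatou : ∫⁻ x, ENNReal.ofReal (φ x - g 0 x) ∂μ.meas ≤
        liminf (fun n => ∫⁻ x, ENNReal.ofReal (g n x - g 0 x) ∂μ.meas) atTop := by
      refine le_trans (le_of_eq ?_) (lintegral_liminf_le fun n =>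
        (((hK n).continuous.sub (hK 0).continuous).measurable.ennreal_ofReal))
      refine lintegral_congr fun x => ?_
      exact ((ENNReal.tendsto_ofReal ((hglim x).sub_const _)).liminf_eq).symm
    refine lt_of_le_of_lt (hfatou.trans (liminf_le_of_frequently_le' (Eventually.frequently
      (Eventually.of_forall fun n => ?_)))) (ENNReal.ofReal_lt_top
        (r := ∫ x, φ x ∂ν.meas - ∫ x, g 0 x ∂μ.meas))
    rw [← ofReal_integral_eq_lintegral_ofReal (f := fun x => g n x - g 0 x) ((hgμ n).sub (hgμ 0))
      (ae_of_all _ (hmono0 n))]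
    refine ENNReal.ofReal_le_ofReal ?_
    rw [integral_sub (hgμ n) (hgμ 0)]
    linarith [hbound n]
  have hφμ : Integrable φ μ.meas := (hdiff.add (hgμ 0)).congr
    (ae_of_all _ fun x => sub_add_cancel (φ x) (g 0 x))
  refine ⟨hφμ, le_of_tendsto' (integral_tendsto_of_tendsto_of_monotone hgμ hφμ
    (ae_of_all _ fun x a b hab => hgmono hab x) (ae_of_all _ hglim)) hbound⟩

lemma isClosed_convexLE_ofLp :
    IsClosed {X : Lp ℝ 1 (volume : Measure I) × Lp ℝ 1 (volume : Measure I) |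
      (ofLp X.1).ConvexLE (ofLp X.2)} := by
  simp only [convexLE_iff_lipschitz, ofPred_forall]
  refine isClosed_iInter fun φ => isClosed_iInter fun _ => isClosed_iInter fun ⟨K, hK⟩ => ?_
  exact isClosed_le ((continuous_integral_ofLp hK).comp continuous_fst)
    ((continuous_integral_ofLp hK).comp continuous_snd)

end ProbMeasOne

namespace Peacock

variable {T : Set ℝ≥0}

instance (θ : Peacock T) (t : T) : IsProbabilityMeasure (θ.meas t) :=
  inferInstanceAs (IsProbabilityMeasure (θ.marginal t).meas)

lemma ext_meas {θ θ' : Peacock T} (h : ∀ t, θ.meas t = θ'.meas t) : θ = θ' := by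
  cases θ; cases θ'
  simp only [Peacock.mk.injEq]
  exact funext fun t => ProbMeasOne.ext_meas (h t)

lemma isInducing_marginal : IsInducing fun θ : Peacock T => θ.marginal := ⟨rfl⟩

lemma continuous_marginal (t : T) : Continuous fun θ : Peacock T => θ.marginal t :=
  (continuous_apply t).comp isInducing_marginal.continuous

lemma measurable_meas (t : T) : Measurable fun θ : Peacock T => θ.meas t :=
  ProbMeasOne.measurable_meas.comp (continuous_marginal t).measurable

lemma measurable_of_meas [Countable T] {Ω : Type*} [MeasurableSpace Ω] {f : Ω → Peacock T}
    (hf : ∀ t, Measurable fun ω => (f ω).meas t) : Measurable f := by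
  have : SecondCountableTopology (Peacock T) := isInducing_marginal.secondCountableTopology
  exact isInducing_marginal.measurable_of_forall fun t => ProbMeasOne.measurable_of_meas (hf t)

/-- The families of integrable random variables whose laws form a peacock. -/
def lpFamilies (T : Set ℝ≥0) : Set (T → Lp ℝ 1 (volume : Measure I)) :=
  {X | ∀ s t : T, s ≤ t → (ProbMeasOne.ofLp (X s)).ConvexLE (ProbMeasOne.ofLp (X t))}

lemma isClosed_lpFamilies : IsClosed (lpFamilies T) := by
  simp only [lpFamilies, ofPred_forall]
  refine isClosed_iInter fun s => isClosed_iInter fun t => isClosed_iInter fun _ => ?_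
  have hst : Continuous fun X : T → Lp ℝ 1 (volume : Measure I) => (X s, X t) :=
    (continuous_apply s).prodMk (continuous_apply t)
  exact ProbMeasOne.isClosed_convexLE_ofLp.preimage hst

/-- The peacock of the laws of a family of random variables. -/
def ofLpFamily (X : lpFamilies T) : Peacock T := ⟨fun t => ProbMeasOne.ofLp (X.1 t), X.2⟩

lemma continuous_ofLpFamily : Continuous (ofLpFamily (T := T)) :=
  isInducing_marginal.continuous_iff.2 (continuous_pi fun t =>
    ProbMeasOne.continuous_ofLp.comp ((continuous_apply t).comp continuous_subtype_val))

lemma exists_ofLpFamily_eq (θ : Peacock T) : ∃ X, ofLpFamily X = θ := by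
  choose X hX using fun t => ProbMeasOne.exists_ofLp_eq (θ.marginal t)
  refine ⟨⟨X, fun s t hst => by rw [hX, hX]; exact θ.convexLE s t hst⟩, ?_⟩
  exact ext_meas fun t => by
    change (ProbMeasOne.ofLp (X t)).meas = (θ.marginal t).meas
    rw [hX]

instance [Countable T] : PolishSpace (lpFamilies T) := by
  have : Fact ((1 : ℝ≥0∞) ≠ ∞) := ⟨ENNReal.one_ne_top⟩
  have : PolishSpace (T → Lp ℝ 1 (volume : Measure I)) := inferInstance
  exact isClosed_lpFamilies.polishSpace

end Peacock

end

/-! ### Barycenters and Jensen's inequality -/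

noncomputable section

open Filter ProbabilityTheory

lemma MeasureTheory.Measure.integral_bind_kernel {α β : Type*} [MeasurableSpace α]
    [MeasurableSpace β] {m : Measure α} {κ : Kernel α β} {f : β → ℝ}
    (hf : Integrable f (m.bind κ)) :
    ∫ y, f y ∂(m.bind κ) = ∫ x, ∫ y, f y ∂(κ x) ∂m := by
  rw [Measure.comp_eq_comp_const_apply] at hf ⊢
  rw [Kernel.integral_comp hf, Kernel.const_apply]

/-- Strong law of large numbers for a function of independent samples. -/
lemma ProbabilityTheory.iIndepFun.ae_tendsto_average {Ω Ω' : Type*} [MeasurableSpace Ω]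
    [MeasurableSpace Ω'] {m : Measure Ω} {P : Measure Ω'} {X : ℕ → Ω' → Ω}
    (hX : iIndepFun X P) (hXm : ∀ i, Measurable (X i)) (hlaw : ∀ i, P.map (X i) = m)
    {h : Ω → ℝ} (hm : Measurable h) (hint : Integrable h m) :
    ∀ᵐ ω ∂P, Tendsto (fun n : ℕ => ((n : ℝ) + 1)⁻¹ * ∑ i ∈ Finset.range (n + 1), h (X i ω)) atTop
      (𝓝 (∫ x, h x ∂m)) := by
  have hint0 : Integrable (fun ω => h (X 0 ω)) P := by
    rw [← hlaw 0] at hint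
    exact hint.comp_measurable (hXm 0)
  have hid : ∀ i, IdentDistrib (fun ω => h (X i ω)) (fun ω => h (X 0 ω)) P P := fun i =>
    (IdentDistrib.mk (hXm i).aemeasurable (hXm 0).aemeasurable
      ((hlaw i).trans (hlaw 0).symm)).comp hm
  have hind : Pairwise (Function.onFun (fun f g : Ω' → ℝ => IndepFun f g P)
      fun i ω => h (X i ω)) := fun i j hij => (hX.comp (fun _ => h) fun _ => hm).indepFun hij
  have hmean : ∫ x, h x ∂m = ∫ ω, h (X 0 ω) ∂P := by
    rw [← hlaw 0, integral_map (hXm 0).aemeasurable hm.aestronglyMeasurable]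
  filter_upwards [strong_law_ae_real (fun i ω => h (X i ω)) hint0 hind hid] with ω hω
  rw [hmean]
  refine (hω.comp (tendsto_add_atTop_nat 1)).congr fun n => ?_
  simp only [Function.comp_apply]
  rw [div_eq_inv_mul]
  push_cast
  rfl

namespace Peacock

variable {T : Set ℝ≥0}

lemma integral_meas_mono (θ : Peacock T) {s t : T} (hst : s ≤ t) {φ : ℝ → ℝ} (hφ : ConvexOn ℝ univ φ)
    {K : ℝ≥0} (hK : LipschitzWith K φ) : ∫ x, φ x ∂θ.meas s ≤ ∫ x, φ x ∂θ.meas t :=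
  (ProbMeasOne.convexLE_iff_lipschitz.1 (θ.convexLE s t hst)) φ hφ ⟨K, hK⟩

/-- Convex combinations of peacocks are peacocks. -/
lemma exists_convexCombination (θ₁ θ₂ : Peacock T) {r s : ℝ≥0} (hrs : r + s = 1) :
    ∃ θ : Peacock T, ∀ t, θ.meas t = r • θ₁.meas t + s • θ₂.meas t := by
  have hprob : ∀ t, IsProbabilityMeasure (r • θ₁.meas t + s • θ₂.meas t) := fun t => ⟨by
    simp only [Measure.add_apply, Measure.smul_apply, measure_univ, ENNReal.smul_def, smul_eq_mul,
      mul_one]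
    exact_mod_cast hrs⟩
  have hint : ∀ t, ∀ f : ℝ → ℝ, Integrable f (θ₁.meas t) → Integrable f (θ₂.meas t) →
      Integrable f (r • θ₁.meas t + s • θ₂.meas t) := fun t f h1 h2 =>
    (h1.smul_measure_nnreal).add_measure h2.smul_measure_nnreal
  refine ⟨⟨fun t => ⟨⟨_, hprob t⟩, hint t _ (θ₁.marginal t).integrable_id
    (θ₂.marginal t).integrable_id⟩, fun a b hab => ?_⟩, fun t => rfl⟩
  refine ProbMeasOne.convexLE_iff_lipschitz.2 fun φ hφ ⟨K, hK⟩ => ?_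
  change ∫ x, φ x ∂(r • θ₁.meas a + s • θ₂.meas a) ≤ ∫ x, φ x ∂(r • θ₁.meas b + s • θ₂.meas b)
  have hi : ∀ (θ : Peacock T) t, Integrable φ (θ.meas t) := fun θ t =>
    (θ.marginal t).integrable_lipschitz hK
  rw [integral_add_measure (hi _ _).smul_measure_nnreal (hi _ _).smul_measure_nnreal,
    integral_add_measure (hi _ _).smul_measure_nnreal (hi _ _).smul_measure_nnreal]
  simp only [integral_smul_nnreal_measure]
  exact add_le_add (smul_le_smul_of_nonneg_left (θ₁.integral_meas_mono hab hφ hK) zero_le)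
    (smul_le_smul_of_nonneg_left (θ₂.integral_meas_mono hab hφ hK) zero_le)

/-- The empirical mean of the first `n + 1` terms of a sequence of peacocks. -/
lemma exists_empirical (x : ℕ → Peacock T) {c : Peacock T → ℝ≥0} (hc : IsLinearCost c) (n : ℕ) :
    ∃ θ : Peacock T,
      (∀ t, θ.meas t = ((n : ℝ≥0) + 1)⁻¹ • ∑ i ∈ Finset.range (n + 1), (x i).meas t) ∧
      c θ = ((n : ℝ≥0) + 1)⁻¹ * ∑ i ∈ Finset.range (n + 1), c (x i) := by
  induction n with
  | zero => exact ⟨x 0, by simp, by simp⟩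
  | succ n ih =>
    obtain ⟨θ, hθ, hcθ⟩ := ih
    have hrs : ((n : ℝ≥0) + 1) / ((n : ℝ≥0) + 2) + ((n : ℝ≥0) + 2)⁻¹ = 1 := by
      field_simp; ring
    have hmul : ((n : ℝ≥0) + 1) / ((n : ℝ≥0) + 2) * ((n : ℝ≥0) + 1)⁻¹ = ((n : ℝ≥0) + 2)⁻¹ := by
      field_simp
    have hn2 : (((n + 1 : ℕ) : ℝ≥0) + 1)⁻¹ = ((n : ℝ≥0) + 2)⁻¹ := by
      push_cast; congr 1; ring
    obtain ⟨θ', hθ'⟩ := exists_convexCombination θ (x (n + 1)) hrs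
    refine ⟨θ', fun t => ?_, ?_⟩
    · rw [hθ' t, hθ t, smul_smul, hmul, hn2, Finset.sum_range_succ _ (n + 1), smul_add]
    · rw [hc _ _ hrs _ _ _ hθ', hcθ, ← mul_assoc, hmul, hn2, Finset.sum_range_succ _ (n + 1),
        mul_add]

section Barycenter

variable {Ω : Type*} [MeasurableSpace Ω] {m : Measure Ω} [IsProbabilityMeasure m]
  {Ξ : Ω → Peacock T}

/-- The marginals of a measurable family of peacocks as Markov kernels. -/
def measKernel (hΞ : ∀ t, Measurable fun ω => (Ξ ω).meas t) (t : T) : Kernel Ω ℝ :=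
  ⟨fun ω => (Ξ ω).meas t, hΞ t⟩

instance (hΞ : ∀ t, Measurable fun ω => (Ξ ω).meas t) (t : T) :
    IsMarkovKernel (measKernel hΞ t) :=
  ⟨fun ω => inferInstanceAs (IsProbabilityMeasure ((Ξ ω).meas t))⟩

/-- The barycenter of a random peacock with finite expected first moments. -/
theorem exists_barycenter (hΞ : ∀ t, Measurable fun ω => (Ξ ω).meas t)
    (hmom : ∀ t, ∫⁻ ω, ∫⁻ x, ‖x‖ₑ ∂(Ξ ω).meas t ∂m < ∞) :
    ∃ θ : Peacock T, ∀ t, θ.meas t = m.bind fun ω => (Ξ ω).meas t := by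
  have hprob : ∀ t, IsProbabilityMeasure (m.bind fun ω => (Ξ ω).meas t) := fun t =>
    inferInstanceAs (IsProbabilityMeasure (m.bind (measKernel hΞ t)))
  have hid : ∀ t, Integrable (fun x : ℝ => x) (m.bind fun ω => (Ξ ω).meas t) := fun t => by
    refine ⟨continuous_id.aestronglyMeasurable, ?_⟩
    rw [HasFiniteIntegral, Measure.lintegral_bind (hΞ t).aemeasurable (by fun_prop)]
    exact hmom t
  let M : T → ProbMeasOne := fun t => ⟨⟨_, hprob t⟩, hid t⟩
  refine ⟨⟨M, fun a b hab => ?_⟩, fun t => rfl⟩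
  refine ProbMeasOne.convexLE_iff_lipschitz.2 fun φ hφ ⟨K, hK⟩ => ?_
  have hint : ∀ t, Integrable φ (m.bind (measKernel hΞ t)) := fun t =>
    (M t).integrable_lipschitz hK
  have hint' : ∀ t, Integrable (fun ω => ∫ x, φ x ∂(Ξ ω).meas t) m := fun t => by
    have := hint t
    rw [Measure.comp_eq_comp_const_apply] at this
    exact this.integral_comp
  change ∫ x, φ x ∂(m.bind (measKernel hΞ a)) ≤ ∫ x, φ x ∂(m.bind (measKernel hΞ b))
  rw [Measure.integral_bind_kernel (hint a), Measure.integral_bind_kernel (hint b)]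
  exact integral_mono (hint' a) (hint' b) fun ω => (Ξ ω).integral_meas_mono hab hφ hK

/-- Jensen's inequality for lower semicontinuous linear costs. -/
theorem cost_barycenter_le [Countable T] {c : Peacock T → ℝ≥0} (hlin : IsLinearCost c)
    (hlsc : LowerSemicontinuous c) (hΞ : ∀ t, Measurable fun ω => (Ξ ω).meas t)
    (hc : Measurable fun ω => c (Ξ ω)) {θ : Peacock T}
    (hθ : ∀ t, θ.meas t = m.bind fun ω => (Ξ ω).meas t) :
    (c θ : ℝ≥0∞) ≤ ∫⁻ ω, c (Ξ ω) ∂m := by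
  rcases eq_or_ne (∫⁻ ω, (c (Ξ ω) : ℝ≥0∞) ∂m) ∞ with htop | htop
  · rw [htop]; exact le_top
  -- Linearity covers only finite combinations. Empirical means of independent samples are such
  -- combinations; by the law of large numbers they converge to the barycenter and their costs to
  -- the mean cost.
  obtain ⟨Ω', _, P, X, hXm, hXlaw, hX, _⟩ := exists_iid ℕ m
  have hlaw : ∀ i, P.map (X i) = m := fun i => (hXlaw i).map_eq
  have hcint : Integrable (fun ω => (c (Ξ ω) : ℝ)) m := by
    refine ⟨hc.coe_nnreal_real.aestronglyMeasurable, ?_⟩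
    rw [hasFiniteIntegral_iff_ofReal (ae_of_all _ fun ω => NNReal.coe_nonneg _)]
    simpa using htop.lt_top
  have hcmean : ∫⁻ ω, (c (Ξ ω) : ℝ≥0∞) ∂m = ENNReal.ofReal (∫ ω, (c (Ξ ω) : ℝ) ∂m) := by
    rw [ofReal_integral_eq_lintegral_ofReal hcint
      (ae_of_all _ fun ω => NNReal.coe_nonneg _)]
    simp
  have h1 := hX.ae_tendsto_average hXm hlaw hc.coe_nnreal_real hcint
  have h2 : ∀ᵐ ω ∂P, ∀ t : T, Tendsto (fun n : ℕ => ((n : ℝ) + 1)⁻¹ *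
      ∑ i ∈ Finset.range (n + 1), ∫ x, |x| ∂(Ξ (X i ω)).meas t) atTop
      (𝓝 (∫ x, |x| ∂θ.meas t)) := ae_all_iff.2 fun t => by
    have hint : Integrable (fun x : ℝ => |x|) (m.bind (measKernel hΞ t)) := by
      have := (θ.marginal t).integrable_id.abs
      change Integrable _ (θ.meas t) at this
      rw [hθ] at this
      exact this
    have hint' := hint
    rw [Measure.comp_eq_comp_const_apply] at hint'
    have h := hX.ae_tendsto_average hXm hlaw (h := fun ω => ∫ x, |x| ∂(Ξ ω).meas t)
      (StronglyMeasurable.integral_kernel (κ := measKernel hΞ t)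
        continuous_abs.stronglyMeasurable).measurable hint'.integral_comp
    have h' := Measure.integral_bind_kernel hint
    change ∫ x, |x| ∂(m.bind fun ω => (Ξ ω).meas t) = ∫ ω, ∫ x, |x| ∂(Ξ ω).meas t ∂m at h'
    rw [hθ t, h']
    exact h
  -- Rational intervals determine weak convergence and `T` is countable, so a single null set serves
  -- for all of them.
  have h3 : ∀ᵐ ω ∂P, ∀ (t : T) (a b : ℚ), Tendsto (fun n : ℕ => ((n : ℝ) + 1)⁻¹ *
      ∑ i ∈ Finset.range (n + 1), ((Ξ (X i ω)).meas t).real (Ioo (a : ℝ) b)) atTop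
      (𝓝 ((θ.meas t).real (Ioo (a : ℝ) b))) :=
    ae_all_iff.2 fun t => ae_all_iff.2 fun a => ae_all_iff.2 fun b => by
    have hm : Measurable fun ω => ((Ξ ω).meas t).real (Ioo (a : ℝ) b) :=
      ((Measure.measurable_coe measurableSet_Ioo).comp (hΞ t)).ennreal_toReal
    have hint : Integrable (fun ω => ((Ξ ω).meas t).real (Ioo (a : ℝ) b)) m :=
      Integrable.of_bound hm.aestronglyMeasurable 1 (ae_of_all _ fun ω => by
        rw [Real.norm_eq_abs, abs_of_nonneg measureReal_nonneg]; exact measureReal_le_one)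
    have h := hX.ae_tendsto_average hXm hlaw hm hint
    have h' : (θ.meas t).real (Ioo (a : ℝ) b) = ∫ ω, ((Ξ ω).meas t).real (Ioo (a : ℝ) b) ∂m := by
      rw [measureReal_def, hθ t, Measure.bind_apply measurableSet_Ioo (hΞ t).aemeasurable]
      exact (integral_toReal ((Measure.measurable_coe measurableSet_Ioo).comp (hΞ t)).aemeasurable
        (ae_of_all _ fun ω => measure_lt_top _ _)).symm
    rw [h']
    exact h
  obtain ⟨ω, hω1, hω2, hω3⟩ := (h1.and (h2.and h3)).exists
  choose E hE hcE using exists_empirical (fun i => Ξ (X i ω)) hlin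
  have hEθ : Tendsto E atTop (𝓝 θ) := by
    rw [isInducing_marginal.tendsto_nhds_iff, tendsto_pi_nhds]
    intro t
    refine ProbMeasOne.tendsto_iff.2 ⟨?_, ?_⟩
    · refine Real.isPiSystem_Ioo_rat.tendsto_probabilityMeasure_of_tendsto_of_mem ?_ ?_ ?_
      · intro s hs
        simp only [mem_iUnion, mem_singleton_iff] at hs
        obtain ⟨a, b, -, rfl⟩ := hs
        exact measurableSet_Ioo
      · intro u hu x hx
        obtain ⟨s, hs, hxs, hsu⟩ :=
          Real.isTopologicalBasis_Ioo_rat.exists_subset_of_mem_open hx hu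
        have hso := Real.isTopologicalBasis_Ioo_rat.isOpen hs
        exact ⟨s, hs, hso.mem_nhds hxs, hsu⟩
      · intro s hs
        simp only [mem_iUnion, mem_singleton_iff] at hs
        obtain ⟨a, b, -, rfl⟩ := hs
        rw [← NNReal.tendsto_coe]
        refine (hω3 t a b).congr fun n => ?_
        change _ = ((E n).meas t).real _
        rw [hE n t]
        simp only [measureReal_def, Measure.smul_apply, Measure.coe_finsetSum, Finset.sum_apply,
          ENNReal.smul_def, smul_eq_mul, ENNReal.toReal_mul, ENNReal.coe_toReal]
        rw [ENNReal.toReal_sum fun i _ => measure_ne_top _ _]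
        push_cast
        rfl
    · refine (hω2 t).congr fun n => ?_
      change _ = ∫ x, |x| ∂(E n).meas t
      have hi : ∀ i ∈ Finset.range (n + 1), Integrable (fun x : ℝ => |x|) ((Ξ (X i ω)).meas t) :=
        fun i _ => ((Ξ (X i ω)).marginal t).integrable_id.abs
      rw [hE n t, integral_smul_nnreal_measure, integral_finsetSum_measure hi]
      simp [NNReal.smul_def]
  have hlim : Tendsto (fun n => (c (E n) : ℝ)) atTop (𝓝 (∫ ω, (c (Ξ ω) : ℝ) ∂m)) := by
    refine hω1.congr fun n => ?_
    rw [hcE n]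
    push_cast
    rfl
  rw [hcmean, ← ENNReal.ofReal_coe_nnreal]
  -- Any level below `c θ` is eventually exceeded by the costs of the empirical means, hence is at
  -- most their limit.
  refine ENNReal.ofReal_le_ofReal (le_of_forall_lt fun y hy => ?_)
  rcases lt_or_ge y 0 with hy0 | hy0
  · exact hy0.trans_le (integral_nonneg fun ω => (c (Ξ ω)).2)
  obtain ⟨z, hyz, hz⟩ := exists_between hy
  have hz0 : 0 ≤ z := hy0.trans hyz.le
  have hev := hEθ.eventually (hlsc θ ⟨z, hz0⟩ (by exact_mod_cast hz))
  refine hyz.trans_le (ge_of_tendsto hlim (hev.mono fun n hn => ?_))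
  have : ((⟨z, hz0⟩ : ℝ≥0) : ℝ) < c (E n) := by exact_mod_cast hn
  exact this.le

end Barycenter

end Peacock

end

/-! ### Randomised competitors and improvements -/

noncomputable section

open Filter ProbabilityTheory

lemma measurableSet_eq_measure {Ω : Type*} [MeasurableSpace Ω] {μ ν : Ω → Measure ℝ}
    [∀ ω, IsFiniteMeasure (μ ω)] (hμ : Measurable μ) (hν : Measurable ν) :
    MeasurableSet {ω | μ ω = ν ω} := by
  have : {ω | μ ω = ν ω} = ⋂ (a : ℚ) (b : ℚ), {ω | μ ω (Ioo (a : ℝ) b) = ν ω (Ioo (a : ℝ) b)} := by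
    ext ω
    simp only [mem_ofPred_eq, mem_iInter]
    exact ⟨fun h a b => by rw [h], fun h => Real.measure_ext_Ioo_rat h⟩
  rw [this]
  exact MeasurableSet.iInter fun a => MeasurableSet.iInter fun b => measurableSet_eq_fun
    ((Measure.measurable_coe measurableSet_Ioo).comp hμ)
    ((Measure.measurable_coe measurableSet_Ioo).comp hν)

namespace Peacock

variable {T : Set ℝ≥0} {h0 : 0 ∈ T} {μ : Peacock T} {ν : I → ProbMeasOne} {c : I → Peacock T → ℝ≥0}

/-- The value is at most the cost of any randomised competitor. -/
theorem optValue_le_of_randomised [Countable T] {Ω : Type*} [MeasurableSpace Ω]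
    [StandardBorelSpace Ω] [Nonempty Ω] (hc : Measurable (Function.uncurry c))
    (hlin : ∀ a, IsLinearCost (c a)) (hlsc : ∀ a, LowerSemicontinuous (c a))
    {θ : I → Peacock T} (hθ : θ ∈ admissible h0 μ ν) (hν : Measurable ν)
    {ρ : Measure (I × Ω)} [IsFiniteMeasure ρ] (hfst : ρ.fst = volume)
    {Ξ : I × Ω → Peacock T} (hΞ : Measurable Ξ)
    (hinit : ∀ᵐ z ∂ρ, (Ξ z).meas ⟨0, h0⟩ = (ν z.1).meas)
    (hmarg : ∀ (t : T) (s : Set ℝ), MeasurableSet s → ∫⁻ z, (Ξ z).meas t s ∂ρ = μ.meas t s) :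
    optValue h0 μ ν c ≤ ∫⁻ z, c z.1 (Ξ z) ∂ρ := by
  classical
  -- Disintegrating over the index turns the randomisation at `a` into a kernel, whose barycenter is
  -- the new peacock.
  set κ : Kernel I Ω := ρ.condKernel with hκ
  have hρ : ρ = volume ⊗ₘ κ := by rw [← hfst]; exact (ρ.disintegrate ρ.condKernel).symm
  have hΞm : ∀ t, Measurable fun z => (Ξ z).meas t := fun t => (measurable_meas t).comp hΞ
  have hsec : ∀ a t, Measurable fun ω => (Ξ (a, ω)).meas t := fun a t =>
    (hΞm t).comp measurable_prodMk_left
  have hlint : ∀ f : I × Ω → ℝ≥0∞, Measurable f → ∫⁻ z, f z ∂ρ = ∫⁻ a, ∫⁻ ω, f (a, ω) ∂κ a :=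
    fun f hf => by rw [hρ, Measure.lintegral_compProd hf]
  set B : T → I → Measure ℝ := fun t a => (κ a).bind fun ω => (Ξ (a, ω)).meas t with hB
  have hBs : ∀ t a s, MeasurableSet s → B t a s = ∫⁻ ω, (Ξ (a, ω)).meas t s ∂κ a :=
    fun t a s hs => Measure.bind_apply hs (hsec a t).aemeasurable
  have hBm : ∀ t, Measurable (B t) := fun t => by
    refine Measure.measurable_of_measurable_coe _ fun s hs => ?_
    simp only [hBs t _ s hs]
    exact Measurable.lintegral_kernel_prod_right' ((Measure.measurable_coe hs).comp (hΞm t))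
  have hBp : ∀ t a, IsProbabilityMeasure (B t a) := fun t a =>
    inferInstanceAs (IsProbabilityMeasure ((κ a).bind (measKernel (hsec a) t)))
  have hmomm : ∀ t, Measurable fun z => ∫⁻ x, ‖x‖ₑ ∂(Ξ z).meas t := fun t =>
    (Measure.measurable_lintegral measurable_enorm).comp (hΞm t)
  set G : Set I := {a | ∀ t, ∫⁻ ω, ∫⁻ x, ‖x‖ₑ ∂(Ξ (a, ω)).meas t ∂κ a < ∞} ∩
    {a | B ⟨0, h0⟩ a = (ν a).meas} with hG
  have hGm : MeasurableSet G := by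
    refine MeasurableSet.inter ?_ (measurableSet_eq_measure (hBm _)
      (ProbMeasOne.measurable_meas.comp hν))
    rw [ofPred_forall]
    exact MeasurableSet.iInter fun t => measurableSet_lt
      (Measurable.lintegral_kernel_prod_right' (hmomm t)) measurable_const
  have hGae : ∀ᵐ a : I, a ∈ G := by
    refine Filter.Eventually.and (ae_all_iff.2 fun t => ?_) ?_
    · refine ae_lt_top (Measurable.lintegral_kernel_prod_right' (hmomm t)) ?_
      rw [← hlint _ (hmomm t)]
      have hbind : ρ.bind (fun z => (Ξ z).meas t) = μ.meas t :=
        Measure.ext fun s hs => by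
          rw [Measure.bind_apply hs (hΞm t).aemeasurable, hmarg t s hs]
      rw [← Measure.lintegral_bind (hΞm t).aemeasurable (by fun_prop), hbind]
      exact (μ.marginal t).integrable_id.2.ne
    · rw [hρ] at hinit
      filter_upwards [Measure.ae_ae_of_ae_compProd hinit] with a ha
      have h1 := Measure.bind_congr_right ha
      rw [Measure.bind_const, measure_univ, one_smul] at h1
      exact h1
  have hbary : ∀ a ∈ G, ∃ η : Peacock T, ∀ t, η.meas t = B t a := fun a ha =>
    exists_barycenter (hsec a) ha.1
  have : Nonempty (Peacock T) := ⟨μ⟩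
  choose! η hη using hbary
  -- Admissibility fixes the initial law at every index, so on the null set where the barycenter may
  -- fail the given admissible family is kept.
  set θ' : I → Peacock T := fun a => if a ∈ G then η a else θ a with hθ'
  have hθ'G : ∀ a ∈ G, ∀ t, (θ' a).meas t = B t a := fun a ha t => by
    simp only [hθ', if_pos ha]; exact hη a ha t
  have hθ'm : Measurable θ' := measurable_of_meas fun t => by
    have : (fun a => (θ' a).meas t) = G.piecewise (B t) fun a => (θ a).meas t := by
      ext1 a
      by_cases ha : a ∈ G
      · rw [piecewise_eq_of_mem _ _ _ ha, hθ'G a ha]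
      · rw [piecewise_eq_of_notMem _ _ _ ha]; simp only [hθ', if_neg ha]
    rw [this]
    exact (hBm t).piecewise hGm ((measurable_meas t).comp hθ.1)
  have hadm : θ' ∈ admissible h0 μ ν := by
    refine ⟨hθ'm, fun a => ?_, fun t s hs => ?_⟩
    · by_cases ha : a ∈ G
      · refine ProbMeasOne.ext_meas ?_
        exact (hθ'G a ha ⟨0, h0⟩).trans ha.2
      · simp only [hθ', if_neg ha]; exact hθ.2.1 a
    · rw [← hmarg t s hs, hlint (fun z => (Ξ z).meas t s) ((Measure.measurable_coe hs).comp (hΞm t))]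
      refine lintegral_congr_ae ?_
      filter_upwards [hGae] with a ha
      rw [hθ'G a ha, hBs t a s hs]
  refine (iInf₂_le θ' hadm).trans ?_
  have hcm : Measurable fun z : I × Ω => (c z.1 (Ξ z) : ℝ≥0∞) :=
    (hc.comp (measurable_fst.prodMk hΞ)).coe_nnreal_ennreal
  rw [hlint _ hcm]
  refine lintegral_mono_ae ?_
  filter_upwards [hGae] with a ha
  exact cost_barycenter_le (hlin a) (hlsc a) (hsec a)
    (hc.comp (measurable_const.prodMk (hΞ.comp measurable_prodMk_left))) (hθ'G a ha)

instance : MeasurableSpace (lpFamilies T) := borel _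

instance : BorelSpace (lpFamilies T) := ⟨rfl⟩

/-- No coupling with bounded marginal densities is carried by the pairs at which an optimizer can
be improved. -/
theorem IsOptimal.false_of_coupling [Countable T] (hc : Measurable (Function.uncurry c))
    (hlin : ∀ a, IsLinearCost (c a)) (hlsc : ∀ a, LowerSemicontinuous (c a)) (hν : Measurable ν)
    (hfin : optValue h0 μ ν c < ∞) {θ : I → Peacock T} (hθ : IsOptimal h0 μ ν c θ)
    {E : Type*} [MeasurableSpace E] {P : Measure E} [IsProbabilityMeasure P] {C : ℝ≥0}
    {p q : E → I} (hp : Measurable p) (hq : Measurable q) (hpC : P.map p ≤ C • volume)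
    (hqC : P.map q ≤ C • volume) {u w : E → lpFamilies T} (hu : Measurable u) (hw : Measurable w)
    (hsum : ∀ e t, (ofLpFamily (u e)).meas t + (ofLpFamily (w e)).meas t =
      (θ (p e)).meas t + (θ (q e)).meas t)
    (hu0 : ∀ e, (θ (p e)).meas ⟨0, h0⟩ = (ofLpFamily (u e)).meas ⟨0, h0⟩)
    (hw0 : ∀ e, (θ (q e)).meas ⟨0, h0⟩ = (ofLpFamily (w e)).meas ⟨0, h0⟩)
    (hlt : ∀ e, c (p e) (ofLpFamily (u e)) + c (q e) (ofLpFamily (w e)) <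
      c (p e) (θ (p e)) + c (q e) (θ (q e))) : False := by
  classical
  have hθm : Measurable θ := hθ.1.1
  obtain ⟨X₀, -⟩ := exists_ofLpFamily_eq μ
  have : Nonempty (lpFamilies T) := ⟨X₀⟩
  -- The two marginals add up to at most `2 * C` times Lebesgue measure; the extra `1` keeps the
  -- denominator positive.
  set δ : ℝ≥0 := (2 * C + 1)⁻¹ with hδ
  have hδ0 : (δ : ℝ≥0∞) ≠ 0 := by
    rw [hδ, ENNReal.coe_ne_zero]
    positivity
  set η : Measure I := δ • (P.map p + P.map q) with hη
  have hηle : η ≤ volume := by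
    refine Measure.le_iff.2 fun s hs => ?_
    have h1 : (P.map p + P.map q) s ≤ (2 * C : ℝ≥0∞) * volume s := by
      rw [Measure.add_apply, two_mul, add_mul]
      exact add_le_add (hpC s) (hqC s)
    have h2 : (δ : ℝ≥0∞) * (2 * C) ≤ 1 := by
      have : δ * (2 * C) ≤ 1 := by
        rw [hδ, inv_mul_le_iff₀ (by positivity), mul_one]
        exact le_self_add
      exact_mod_cast this
    calc η s = δ * (P.map p + P.map q) s := rfl
      _ ≤ δ * ((2 * C : ℝ≥0∞) * volume s) := by gcongr
      _ = δ * (2 * C) * volume s := (mul_assoc _ _ _).symm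
      _ ≤ 1 * volume s := by gcongr
      _ = volume s := one_mul _
  have hηfin : IsFiniteMeasure η := isFiniteMeasure_of_le _ hηle
  set κ₀ : Measure I := volume - η with hκ₀
  have hκ₀le : κ₀ ≤ volume := Measure.sub_le
  have hκ₀η : κ₀ + η = volume := Measure.sub_add_cancel_of_le hηle
  have hκ₀fin : IsFiniteMeasure κ₀ := isFiniteMeasure_of_le _ hκ₀le
  have hvol : ∀ g : I → ℝ≥0∞, Measurable g →
      ∫⁻ a, g a = ∫⁻ a, g a ∂κ₀ + δ * ∫⁻ e, (g (p e) + g (q e)) ∂P := fun g hg => by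
    rw [← hκ₀η, lintegral_add_measure, hη, lintegral_smul_measure, lintegral_add_measure,
      lintegral_map hg hp, lintegral_map hg hq, lintegral_add_left (f := fun e => g (p e)) (hg.comp hp)]
    rfl
  set fu : E → I × (Bool × lpFamilies T) := fun e => (p e, (true, u e)) with hfu
  set fw : E → I × (Bool × lpFamilies T) := fun e => (q e, (true, w e)) with hfw
  set f₀ : I → I × (Bool × lpFamilies T) := fun a => (a, (false, X₀)) with hf₀
  have hfum : Measurable fu := hp.prodMk (measurable_const.prodMk hu)
  have hfwm : Measurable fw := hq.prodMk (measurable_const.prodMk hw)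
  have hf₀m : Measurable f₀ := measurable_id.prodMk measurable_const
  -- The flag `true` marks mass moved to an improving peacock and `false` mass left with `θ`, for
  -- which `X₀` is a dummy.
  set ρ : Measure (I × (Bool × lpFamilies T)) := κ₀.map f₀ + δ • (P.map fu + P.map fw) with hρ
  have hρint : ∀ g : I × (Bool × lpFamilies T) → ℝ≥0∞, Measurable g →
      ∫⁻ z, g z ∂ρ = ∫⁻ a, g (f₀ a) ∂κ₀ + δ * ∫⁻ e, (g (fu e) + g (fw e)) ∂P := fun g hg => by
    rw [hρ, lintegral_add_measure, lintegral_smul_measure, lintegral_add_measure,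
      lintegral_map hg hfum, lintegral_map hg hfwm, lintegral_map hg hf₀m,
      lintegral_add_left (f := fun e => g (fu e)) (hg.comp hfum)]
    rfl
  have hρfin : IsFiniteMeasure ρ := by rw [hρ]; infer_instance
  have hfst : ρ.fst = volume := Measure.ext fun s hs => by
    rw [Measure.fst_apply hs, ← lintegral_indicator_one (measurable_fst hs),
      ← lintegral_indicator_one hs, hvol _ (measurable_one.indicator hs),
      hρint _ (measurable_one.indicator (measurable_fst hs))]
    rfl
  set Ξ : I × (Bool × lpFamilies T) → Peacock T := fun z =>
    if z.2.1 = true then ofLpFamily z.2.2 else θ z.1 with hΞ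
  have hΞm : Measurable Ξ := by
    refine Measurable.ite (measurableSet_eq_fun (measurable_fst.comp measurable_snd)
      measurable_const) ?_ (hθm.comp measurable_fst)
    exact continuous_ofLpFamily.measurable.comp (measurable_snd.comp measurable_snd)
  have hΞu : ∀ e, Ξ (fu e) = ofLpFamily (u e) := fun e => rfl
  have hΞw : ∀ e, Ξ (fw e) = ofLpFamily (w e) := fun e => rfl
  have hΞ₀ : ∀ a, Ξ (f₀ a) = θ a := fun a => rfl
  have hθ0 : ∀ a, (θ a).meas ⟨0, h0⟩ = (ν a).meas := fun a =>
    congrArg ProbMeasOne.meas (hθ.1.2.1 a)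
  have hinitm : MeasurableSet {z : I × (Bool × lpFamilies T) |
      (Ξ z).meas ⟨0, h0⟩ = (ν z.1).meas} :=
    measurableSet_eq_measure ((measurable_meas _).comp hΞm)
      ((ProbMeasOne.measurable_meas.comp hν).comp measurable_fst)
  have hinit : ∀ᵐ z ∂ρ, (Ξ z).meas ⟨0, h0⟩ = (ν z.1).meas := by
    refine ae_add_measure_iff.2 ⟨?_, ?_⟩
    · exact (ae_map_iff hf₀m.aemeasurable hinitm).2 (ae_of_all _ fun a => hθ0 a)
    · refine Measure.ae_smul_measure (ae_add_measure_iff.2 ⟨?_, ?_⟩) δ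
      · exact (ae_map_iff hfum.aemeasurable hinitm).2
          (ae_of_all _ fun e => (hu0 e).symm.trans (hθ0 _))
      · exact (ae_map_iff hfwm.aemeasurable hinitm).2
          (ae_of_all _ fun e => (hw0 e).symm.trans (hθ0 _))
  have hmarg : ∀ (t : T) (s : Set ℝ), MeasurableSet s →
      ∫⁻ z, (Ξ z).meas t s ∂ρ = μ.meas t s := fun t s hs => by
    rw [hρint (fun z => (Ξ z).meas t s)
        ((Measure.measurable_coe hs).comp ((measurable_meas t).comp hΞm)),
      ← hθ.1.2.2 t s hs, hvol (fun a => (θ a).meas t s)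
        ((Measure.measurable_coe hs).comp ((measurable_meas t).comp hθm))]
    congr 2
    refine lintegral_congr fun e => ?_
    rw [hΞu, hΞw, ← Measure.add_apply, hsum e t]
    rfl
  have hle := optValue_le_of_randomised hc hlin hlsc hθ.1 hν hfst hΞm hinit hmarg
  have hcθ : Measurable fun a => (c a (θ a) : ℝ≥0∞) :=
    (hc.comp (measurable_id.prodMk hθm)).coe_nnreal_ennreal
  have hcΞ : Measurable fun z : I × (Bool × lpFamilies T) => (c z.1 (Ξ z) : ℝ≥0∞) :=
    (hc.comp (measurable_fst.prodMk hΞm)).coe_nnreal_ennreal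
  have hval : ∫⁻ a, (c a (θ a) : ℝ≥0∞) = optValue h0 μ ν c := hθ.2
  have hvalfin := hfin
  rw [← hval, hvol _ hcθ] at hvalfin
  rw [← hval, hvol _ hcθ, hρint _ hcΞ] at hle
  -- Finiteness lets the unchanged part be cancelled and keeps the gain on the replaced part strict.
  have hfin1 : ∫⁻ a, (c a (θ a) : ℝ≥0∞) ∂κ₀ ≠ ∞ :=
    (lt_of_le_of_lt le_self_add hvalfin).ne
  have hfin2 : ∫⁻ e, ((c (p e) (θ (p e)) : ℝ≥0∞) + c (q e) (θ (q e))) ∂P ≠ ∞ := fun h => by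
    rw [h, ENNReal.mul_top hδ0, add_top] at hvalfin
    exact lt_irrefl _ hvalfin
  have hstrict : ∀ e, (c (p e) (ofLpFamily (u e)) : ℝ≥0∞) + c (q e) (ofLpFamily (w e)) <
      c (p e) (θ (p e)) + c (q e) (θ (q e)) := fun e => by exact_mod_cast hlt e
  have hless : ∫⁻ e, ((c (p e) (ofLpFamily (u e)) : ℝ≥0∞) + c (q e) (ofLpFamily (w e))) ∂P <
      ∫⁻ e, ((c (p e) (θ (p e)) : ℝ≥0∞) + c (q e) (θ (q e))) ∂P := by
    refine lintegral_strict_mono (IsProbabilityMeasure.ne_zero P)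
      ((hcθ.comp hp).add (hcθ.comp hq)).aemeasurable ?_ (ae_of_all _ hstrict)
    exact (lt_of_le_of_lt (lintegral_mono fun e => (hstrict e).le) hfin2.lt_top).ne
  refine absurd hle (not_le.2 ?_)
  refine ENNReal.add_lt_add_left hfin1 ?_
  exact (ENNReal.mul_lt_mul_iff_right hδ0 ENNReal.coe_ne_top).2 hless

/-- The pairs of indices at which `θ` can be improved, with the improving peacocks. -/
def improvements (h0 : 0 ∈ T) (c : I → Peacock T → ℝ≥0) (θ : I → Peacock T) :
    Set (I × I × lpFamilies T × lpFamilies T) :=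
  {z | (∀ t, (ofLpFamily z.2.2.1).meas t + (ofLpFamily z.2.2.2).meas t =
      (θ z.1).meas t + (θ z.2.1).meas t) ∧
    (θ z.1).meas ⟨0, h0⟩ = (ofLpFamily z.2.2.1).meas ⟨0, h0⟩ ∧
    (θ z.2.1).meas ⟨0, h0⟩ = (ofLpFamily z.2.2.2).meas ⟨0, h0⟩ ∧
    c z.1 (ofLpFamily z.2.2.1) + c z.2.1 (ofLpFamily z.2.2.2) <
      c z.1 (θ z.1) + c z.2.1 (θ z.2.1)}

lemma measurableSet_improvements [Countable T] (hc : Measurable (Function.uncurry c))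
    {θ : I → Peacock T} (hθ : Measurable θ) : MeasurableSet (improvements h0 c θ) := by
  have hL : Measurable (ofLpFamily (T := T)) := continuous_ofLpFamily.measurable
  have h1 : Measurable fun z : I × I × lpFamilies T × lpFamilies T => z.1 := measurable_fst
  have h2 : Measurable fun z : I × I × lpFamilies T × lpFamilies T => z.2.1 :=
    measurable_fst.comp measurable_snd
  have h3 : Measurable fun z : I × I × lpFamilies T × lpFamilies T => ofLpFamily z.2.2.1 :=
    hL.comp (measurable_fst.comp (measurable_snd.comp measurable_snd))
  have h4 : Measurable fun z : I × I × lpFamilies T × lpFamilies T => ofLpFamily z.2.2.2 :=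
    hL.comp (measurable_snd.comp (measurable_snd.comp measurable_snd))
  have h5 := hθ.comp h1
  have h6 := hθ.comp h2
  simp only [improvements, ofPred_and, ofPred_forall]
  refine MeasurableSet.inter ?_ (MeasurableSet.inter ?_ (MeasurableSet.inter ?_ ?_))
  · exact MeasurableSet.iInter fun t => measurableSet_eq_measure
      (((measurable_meas t).comp h3).add ((measurable_meas t).comp h4))
      (((measurable_meas t).comp h5).add ((measurable_meas t).comp h6))
  · exact measurableSet_eq_measure ((measurable_meas _).comp h5) ((measurable_meas _).comp h3)
  · exact measurableSet_eq_measure ((measurable_meas _).comp h6) ((measurable_meas _).comp h4)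
  · exact measurableSet_lt ((hc.comp (h1.prodMk h3)).add (hc.comp (h2.prodMk h4)))
      ((hc.comp (h1.prodMk h5)).add (hc.comp (h2.prodMk h6)))

end Peacock

end

/-! ### The main theorem -/

theorem proposition5p7 (T : Set ℝ≥0) (hT : T.Countable) (h0 : 0 ∈ T)
    (μ : Peacock T) (ν : I → ProbMeasOne) (hν : Measurable ν)
    (c : I → Peacock T → ℝ≥0) (hc : Measurable (Function.uncurry c))
    (hlin : ∀ a : I, Peacock.IsLinearCost (c a))
    (hlsc : ∀ a : I, LowerSemicontinuous (c a))
    (hfin : Peacock.optValue h0 μ ν c < ∞)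
    (θ : I → Peacock T) (hθ : Peacock.IsOptimal h0 μ ν c θ) :
    ∃ A : Set I, MeasurableSet A ∧ volume A = 1 ∧
      ∀ a ∈ A, ∀ a' ∈ A, a < a' → ∀ θ' θ'' : Peacock T,
        (∀ t : T, θ'.meas t + θ''.meas t = (θ a).meas t + (θ a').meas t) →
        (θ a).meas ⟨0, h0⟩ = θ'.meas ⟨0, h0⟩ →
        (θ a').meas ⟨0, h0⟩ = θ''.meas ⟨0, h0⟩ →
        c a (θ a) + c a' (θ a') ≤ c a θ' + c a' θ'' := by
  have : Countable T := hT.to_subtype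
  suffices h : ∃ N : Set I, MeasurableSet N ∧ volume N = 0 ∧
      ∀ z ∈ Peacock.improvements h0 c θ, z.1 ∈ N ∨ z.2.1 ∈ N by
    obtain ⟨N, hN, hN0, hcov⟩ := h
    refine ⟨Nᶜ, hN.compl, (prob_compl_eq_one_iff hN).2 hN0,
      fun a ha a' ha' _ θ' θ'' hsum h1 h2 => ?_⟩
    by_contra! hlt
    obtain ⟨X, rfl⟩ := Peacock.exists_ofLpFamily_eq θ'
    obtain ⟨Y, rfl⟩ := Peacock.exists_ofLpFamily_eq θ''
    exact (hcov (a, a', X, Y) ⟨hsum, h1, h2, hlt⟩).elim ha ha'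
  -- The dichotomy is applied to a continuous parametrisation of edges with their improving pairs.
  -- Keeping the pairs in the parametrisation makes the choice of an improvement automatically
  -- measurable in the parameter.
  have han := (Peacock.measurableSet_improvements (h0 := h0) hc hθ.1.1).analyticSet
  rw [AnalyticSet] at han
  rcases han with hempty | ⟨g, hg, hrange⟩
  · exact ⟨∅, MeasurableSet.empty, measure_empty, fun z hz => by rw [hempty] at hz; exact hz.elim⟩
  have hmem : ∀ e, g e ∈ Peacock.improvements h0 c θ := fun e => hrange ▸ mem_range_self e
  rcases exists_null_cover_or_coupling (continuous_fst.comp hg)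
    (continuous_fst.comp (continuous_snd.comp hg)) with ⟨N, hN, hN0, hcov⟩ | ⟨P, C, hpC, hqC⟩
  · refine ⟨N, hN, hN0, fun z hz => ?_⟩
    rw [← hrange] at hz
    obtain ⟨e, rfl⟩ := hz
    exact hcov e
  · exact (hθ.false_of_coupling hc hlin hlsc hν hfin
      (continuous_fst.comp hg).measurable (continuous_fst.comp (continuous_snd.comp hg)).measurable
      hpC hqC
      (continuous_fst.comp (continuous_snd.comp (continuous_snd.comp hg))).measurable
      (continuous_snd.comp (continuous_snd.comp (continuous_snd.comp hg))).measurable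
      (fun e => (hmem e).1) (fun e => (hmem e).2.1) (fun e => (hmem e).2.2.1)
      fun e => (hmem e).2.2.2).elim
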